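/- **Setting.** Let $\Sigma$ be a Riemann surface (a surface with a fixed conformal structure and its complex structure $J$), and let $\mathbb C^{n+2}=(\mathbb R^{n+1,1})^{\mathbb C}$ carry the complex bilinear extension $(\cdot,\cdot)$ of the metric of signature $(n+1,1)$. All bundles are smooth complex subbundles of the trivial bundle $\underline{\mathbb C}^{n+2}=\Sigma\times\mathbb C^{n+2}$, with trivial connection $d$; identify $u\wedge v$ with the skew endomorphism $w\mapsto (u,w)v-(v,w)u$. One-forms are smooth and complex valued, and $\alpha=\alpha^{1,0}+\alpha^{0,1}$ is the type decomposition. For a connection $\hat d$ on $\underline{\mathbb C}^{n+2}$ and a non-degenerate subbundle $V$ with orthogonal projections $\pi_V,\pi_{V^\perp}$, write $\hat d=\mathcal D_V^{\hat d}+\mathcal N_V^{\hat d}$ with $\mathcal D_V^{\hat d}=\pi_V\circ\hat d\circ\pi_V+\pi_{V^\perp}\circ\hat d\circ\pi_{V^\perp}$, and for a one-form $q$ with values in $\wedge^2V\oplus\wedge^2V^\perp$ and $\lambda\in\mathbb C\setminus\{0\}$ put $$\hat d^{\lambda,q}_V=\mathcal D_V^{\hat d}+\lambda^{-1}(\mathcal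 N_V^{\hat d})^{1,0}+\lambda(\mathcal N_V^{\hat d})^{0,1}+(\lambda^{-2}-1)q^{1,0}+(\lambda^2-1)q^{0,1}.$$ In what follows $\hat d=d$, and then the superscript $\hat d$ in $\mathcal D_V,\mathcal N_V$ is omitted. * $V$ is *$q$-constrained harmonic* if it is non-degenerate, $q$ takes values in $\wedge^2V\oplus\wedge^2V^\perp$, and $d^{\lambda,q}_V$ is flat for every $\lambda\in\mathbb C\setminus\{0\}$. * A *surface* is a pair $(\Lambda^{1,0},\Lambda^{0,1})$ of isotropic rank $2$ subbundles meeting in a rank $1$ bundle $\Lambda=\Lambda^{1,0}\cap\Lambda^{0,1}$, with $d^{1,0}\Gamma\Lambda\subset\Omega^{1,0}\Lambda^{1,0}$ and $d^{0,1}\Gamma\Lambda\subset\Omega^{0,1}\Lambda^{0,1}$. * A *central sphere congruence* of it is a non-degenerate rank $4$ bundle $V\supset\Lambda^{1,0}+\Lambda^{0,1}$ with $\mathcal N_V^{1,0}\Lambda^{0,1}=0=\mathcal N_V^{0,1}\Lambda^{1,0}$. * A surface is *$q$-constrained Willmore* if it has a $q$-constrained harmonic central sphere congruence, where $q^{1,0}$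 takes values in $\wedge^2\Lambda^{0,1}$ and $q^{0,1}$ in $\wedge^2\Lambda^{1,0}$. * A surface is *real* if $\Lambda$ is invariant under complex conjugation and is an immersion, i.e. $\langle\sigma,d\sigma(T\Sigma)\rangle$ has rank $3$ for nowhere zero local sections $\sigma$ of $\Lambda$. It is a *real $q$-constrained Willmore surface* if it is a $q$-constrained Willmore surface, it is real, and $q$ is a real form. **Theorem.** Let $(\Lambda^{1,0},\Lambda^{0,1})$ be a surface with a central sphere congruence $V$ that is $q$-constrained harmonic, with $q^{1,0}$ valued in $\wedge^2\Lambda^{0,1}$ and $q^{0,1}$ in $\wedge^2\Lambda^{1,0}$. For $\lambda\in\mathbb C\setminus\{0\}$ put $q_\lambda=\lambda^{-2}q^{1,0}+\lambda^2q^{0,1}$. By a *parallel isometry* $\phi:(\underline{\mathbb C}^{n+2},d^{\lambda,q}_V)\to(\underline{\mathbb C}^{n+2},d)$ we mean a smooth bundle isometry with $d\circ\phi=\phi\circ d^{\lambda,q}_V$; put $\mathrm{Ad}_\phi q_\lambda=\phi\, q_\lambda\,\phi^{-1}$. 1. For every $\lambda\in\mathbb C\setminus\{0\}$ and every parallel isometry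 $\phi:(\underline{\mathbb C}^{n+2},d^{\lambda,q}_V)\to(\underline{\mathbb C}^{n+2},d)$, the bundle $V^\lambda_q=\phi V$ is $\mathrm{Ad}_\phi q_\lambda$-constrained harmonic and is a central sphere congruence of $(\phi\Lambda^{1,0},\phi\Lambda^{0,1})$; moreover $(\mathrm{Ad}_\phi q_\lambda)^{1,0}$ takes values in $\wedge^2\phi\Lambda^{0,1}$ and $(\mathrm{Ad}_\phi q_\lambda)^{0,1}$ in $\wedge^2\phi\Lambda^{1,0}$, so that $(\phi\Lambda^{1,0},\phi\Lambda^{0,1})$ is an $\mathrm{Ad}_\phi q_\lambda$-constrained Willmore surface. 2. Suppose in addition that $(\Lambda^{1,0},\Lambda^{0,1})$ is a real surface and $q$ is a real form, and let $|\lambda|=1$. If there is a parallel isometry $\phi$ as above, then there is a real one $\psi$ (commuting with complex conjugation) such that $\psi\circ\phi^{-1}$ is locally constant. For every real parallel isometry $\phi$, $(\phi\Lambda^{1,0},\phi\Lambda^{0,1})$, with $\Lambda^\lambda_q=\phi\Lambda$, is a real $\mathrm{Ad}_\phi q_\lambda$-constrained Willmore surface. -/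

import Mathlib

open scoped Manifold ContDiff

noncomputable section

namespace Willmore

/-! ### The complexified Lorentzian space -/

/-- The complex vector space `ℂⁿ⁺² = (ℝⁿ⁺¹'¹) ⊗ ℂ`. -/
abbrev E (n : ℕ) : Type := Fin (n + 2) → ℂ

/-- Endomorphisms of `ℂⁿ⁺²`. -/
abbrev EndE (n : ℕ) : Type := E n →L[ℂ] E n

/-- The complex bilinear extension of the metric of signature `(n+1, 1)`. -/
def bil (n : ℕ) : LinearMap.BilinForm ℂ (E n) :=
  LinearMap.mk₂ ℂ
    (fun u v => (∑ i : Fin (n + 1), u i.castSucc * v i.castSucc)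
      - u (Fin.last (n + 1)) * v (Fin.last (n + 1)))
    (by intro u u' v; simp [add_mul, Finset.sum_add_distrib]; ring)
    (by intro c u v; simp [Finset.mul_sum, mul_sub, mul_assoc])
    (by intro u v v'; simp [mul_add, Finset.sum_add_distrib]; ring)
    (by intro c u v; simp [Finset.mul_sum, mul_sub, mul_left_comm])

/-- Complex conjugation on `ℂⁿ⁺²`, whose fixed points form `ℝⁿ⁺¹'¹`. -/
def conjE {n : ℕ} (w : E n) : E n := fun i => (starRingEnd ℂ) (w i)

/-- `W` is isotropic for the metric. -/
def IsIsotropic {n : ℕ} (W : Submodule ℂ (E n)) : Prop :=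
  ∀ u ∈ W, ∀ w ∈ W, bil n u w = 0

/-- `W` is non-degenerate: the metric restricts to a non-degenerate form on `W`. -/
def IsNondeg {n : ℕ} (W : Submodule ℂ (E n)) : Prop :=
  ((bil n).restrict W).Nondegenerate

/-- The orthogonal complement `W^⊥`. -/
def perp {n : ℕ} (W : Submodule ℂ (E n)) : Submodule ℂ (E n) := (bil n).orthogonal W

open Classical in
/-- The orthogonal projection onto `W`, along `W^⊥` (with junk value `0` when `W` is degenerate,
that is, when `W` and `W^⊥` are not complementary). -/
def orthProj {n : ℕ} (W : Submodule ℂ (E n)) : EndE n :=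
  if h : IsCompl W (perp W) then LinearMap.toContinuousLinearMap (W.projection (perp W) h) else 0

/-- The endomorphism `u ∧ v`, `(u ∧ v)(w) = (u,w) v - (v,w) u`. -/
def wedge {n : ℕ} (u v : E n) : EndE n :=
  LinearMap.toContinuousLinearMap
    ((bil n u).smulRight v - (bil n v).smulRight u)

/-- `∧²W`, as a subspace of the endomorphisms. -/
def wedgeSq {n : ℕ} (W : Submodule ℂ (E n)) : Submodule ℂ (EndE n) :=
  Submodule.span ℂ {A | ∃ u ∈ W, ∃ v ∈ W, A = wedge u v}

/-! ### One-forms on a Riemann surface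

`M` is a Riemann surface: a space with an atlas of complex charts with holomorphic transition maps.
Its underlying smooth surface has the model `𝓘(ℝ, ℂ)`. -/

section Forms

variable {M : Type*} [TopologicalSpace M] [ChartedSpace ℂ M]

/-- A Riemann surface is a real analytic (in particular, a smooth) surface. -/
instance instIsManifoldReal [IsManifold 𝓘(ℂ) ω M] : IsManifold 𝓘(ℝ, ℂ) ω M := by
  refine isManifold_of_contDiffOn _ _ _ fun e e' he he' => ?_
  have h := (contDiffGroupoid ω 𝓘(ℂ)).compatible he he'
  rw [contDiffGroupoid, mem_groupoid_of_pregroupoid] at h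
  exact ContDiffOn.restrict_scalars ℝ h.1

/-- The (real) tangent space of the surface. -/
abbrev T (x : M) : Type := TangentSpace 𝓘(ℝ, ℂ) x

/-- The complex structure `J` of the tangent spaces. The tangent space at `x` is a copy of `ℂ`, by
means of a holomorphic chart at `x`, and `J` is multiplication by `i` there (which does not depend
on the holomorphic chart). -/
def J (x : M) : T x →L[ℝ] T x :=
  (Complex.I • ContinuousLinearMap.id ℝ ℂ : ℂ →L[ℝ] ℂ)

variable (M) in
/-- (Complex) one-forms on the surface with values in the complex vector space `F`: a complex
linear form on `TM ⊗ ℂ` is the same as a real linear one on `TM`. -/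
abbrev Form (F : Type*) [NormedAddCommGroup F] [NormedSpace ℝ F] : Type _ :=
  (x : M) → T x →L[ℝ] F

section Types

variable {F : Type*} [NormedAddCommGroup F] [NormedSpace ℝ F] [NormedSpace ℂ F]
  [SMulCommClass ℝ ℂ F]

/-- The `(1,0)`-part of a one-form, `v ↦ α((v - i J v) / 2)`. -/
def part10 (α : Form M F) : Form M F := fun x =>
  (1 / 2 : ℂ) • (α x - Complex.I • (α x).comp (J x))

/-- The `(0,1)`-part of a one-form, `v ↦ α((v + i J v) / 2)`. -/
def part01 (α : Form M F) : Form M F := fun x =>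
  (1 / 2 : ℂ) • (α x + Complex.I • (α x).comp (J x))

end Types

/-- The vector field `X` is smooth on `U`. -/
def SmoothFieldOn [IsManifold 𝓘(ℂ) ω M] (X : (x : M) → T x) (U : Set M) : Prop :=
  ContMDiffOn 𝓘(ℝ, ℂ) 𝓘(ℝ, ℂ).tangent ∞ (fun x => (⟨x, X x⟩ : TangentBundle 𝓘(ℝ, ℂ) M)) U

/-- The map `s` into the normed space `F` is smooth on `U`. -/
def SmoothOn {F : Type*} [NormedAddCommGroup F] [NormedSpace ℝ F] (s : M → F) (U : Set M) : Prop :=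
  ContMDiffOn 𝓘(ℝ, ℂ) 𝓘(ℝ, F) ∞ s U

/-- The one-form `α` is smooth: `α(X)` is smooth for all smooth local vector fields `X`. -/
def SmoothForm [IsManifold 𝓘(ℂ) ω M] {F : Type*} [NormedAddCommGroup F] [NormedSpace ℝ F]
    (α : Form M F) : Prop :=
  ∀ U : Set M, IsOpen U → ∀ X : (x : M) → T x, SmoothFieldOn X U →
    SmoothOn (fun x => α x (X x)) U

/-- The differential `df` of a map `f` into the normed space `F`, as a one-form. -/
def diff {F : Type*} [NormedAddCommGroup F] [NormedSpace ℝ F] (f : M → F) : Form M F := fun x =>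
  mfderiv 𝓘(ℝ, ℂ) 𝓘(ℝ, F) f x

/-! ### Connections on the trivial bundle

Each connection on the trivial bundle `M × ℂⁿ⁺²` is `d + a` for exactly one one-form `a` with
values in the endomorphisms; it is represented by `a`. The trivial connection `d` is `0`. -/

/-- The covariant derivative `∇s = ds + a s` of the section `s`, for `∇ = d + a`. -/
def cov {n : ℕ} (a : Form M (EndE n)) (s : M → E n) : Form M (E n) := fun x =>
  diff s x + ((ContinuousLinearMap.apply ℂ (E n) (s x)).restrictScalars ℝ).comp (a x)

/-- The connection `∇ = d + a` is flat: its curvature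
`R(X,Y)s = ∇_X ∇_Y s - ∇_Y ∇_X s - ∇_[X,Y] s` vanishes for all smooth local `X`, `Y`, `s`. -/
def IsFlat [IsManifold 𝓘(ℂ) ω M] {n : ℕ} (a : Form M (EndE n)) : Prop :=
  ∀ U : Set M, IsOpen U → ∀ X Y : (x : M) → T x, SmoothFieldOn X U → SmoothFieldOn Y U →
    ∀ s : M → E n, SmoothOn s U → ∀ x ∈ U,
      cov a (fun y => cov a s y (Y y)) x (X x) - cov a (fun y => cov a s y (X y)) x (Y x)
        - cov a s x (VectorField.mlieBracket 𝓘(ℝ, ℂ) X Y x) = 0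

/-! ### Subbundles of the trivial bundle -/

/-- `V` is a smooth complex subbundle of rank `r` of the trivial bundle. -/
def IsSubbundle {n : ℕ} (r : ℕ) (V : M → Submodule ℂ (E n)) : Prop :=
  ∀ x : M, ∃ U : Set M, IsOpen U ∧ x ∈ U ∧ ∃ s : Fin r → M → E n,
    (∀ i, SmoothOn (s i) U) ∧
    ∀ y ∈ U, LinearIndependent ℂ (fun i => s i y) ∧
      V y = Submodule.span ℂ (Set.range fun i => s i y)

/-- `s` is a smooth section of `V` over the open set `U`. -/
def IsSection {n : ℕ} (V : M → Submodule ℂ (E n)) (U : Set M) (s : M → E n) : Prop :=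
  IsOpen U ∧ SmoothOn s U ∧ ∀ y ∈ U, s y ∈ V y

/-- The field `x ↦ π_{V_x}` of orthogonal projections onto `V`. -/
def projV {n : ℕ} (V : M → Submodule ℂ (E n)) : M → EndE n := fun x => orthProj (V x)

/-- For `∇ = d + a` and fields `P`, `Q` of endomorphisms, the one-form
`v ↦ Q ∘ ∇_v ∘ P = Q ∘ (dP(v) + a(v) ∘ P)` on constant sections. -/
def sandwich {n : ℕ} (a : Form M (EndE n)) (Q P : M → EndE n) : Form M (EndE n) := fun x =>
  ((ContinuousLinearMap.compL ℂ (E n) (E n) (E n) (Q x)).restrictScalars ℝ).comp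
    (diff P x + (((ContinuousLinearMap.compL ℂ (E n) (E n) (E n)).flip (P x)).restrictScalars
      ℝ).comp (a x))

/-- The connection `𝒟_V^∇ = π_V ∘ ∇ ∘ π_V + π_{V^⊥} ∘ ∇ ∘ π_{V^⊥}`, the sum of the connections
that `∇ = d + a` induces on `V` and `V^⊥` (as always, it is represented by the one-form by which it
differs from `d`, that is, by its action on constant sections; see `cov_connD`). -/
def connD {n : ℕ} (a : Form M (EndE n)) (V : M → Submodule ℂ (E n)) : Form M (EndE n) := fun x =>
  sandwich a (projV V) (projV V) x + sandwich a (1 - projV V) (1 - projV V) x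

/-- Product rule for an endomorphism valued function applied to a section. -/
theorem diff_clm_apply {n : ℕ} {P : M → EndE n} {s : M → E n} {x : M}
    (hP : MDifferentiableAt 𝓘(ℝ, ℂ) 𝓘(ℝ, EndE n) P x)
    (hs : MDifferentiableAt 𝓘(ℝ, ℂ) 𝓘(ℝ, E n) s x)
    (v : T x) : diff (fun y => P y (s y)) x v = diff P x v (s x) + P x (diff s x v) := by
  have hb : IsBoundedBilinearMap ℝ (fun p : EndE n × E n => p.1 p.2) :=
    { add_left := by intros; simp
      smul_left := by intros; simp
      add_right := by intros; simp
      smul_right := by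
        intro c f y
        change f (((c : ℂ)) • y) = ((c:ℂ)) • f y
        exact f.map_smul _ _
      bound := ⟨1, one_pos, fun f y => by simpa using f.le_opNorm y⟩ }
  have h1 := hP.hasMFDerivAt
  have h2 := hs.hasMFDerivAt
  have h3 : HasMFDerivAt 𝓘(ℝ, ℂ) 𝓘(ℝ, E n) (fun y => P y (s y)) x ((hb.deriv (P x, s x)).comp
      (((diff P x : T x →L[ℝ] EndE n)).prod (diff s x : T x →L[ℝ] E n)) : T x →L[ℝ] E n) := by
    refine ⟨h1.1.clm_apply h2.1, ?_⟩
    have h4 := h1.2.prodMk h2.2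
    have e : (writtenInExtChartAt 𝓘(ℝ, ℂ) 𝓘(ℝ, EndE n) x P (extChartAt 𝓘(ℝ, ℂ) x x),
      writtenInExtChartAt 𝓘(ℝ, ℂ) 𝓘(ℝ, E n) x s (extChartAt 𝓘(ℝ, ℂ) x x)) = (P x, s x) := by
      simp [writtenInExtChartAt]
      exact ⟨rfl, rfl⟩
    have h5 := hb.hasFDerivAt (P x, s x)
    rw [← e] at h5
    have := HasFDerivAt.comp_hasFDerivWithinAt (extChartAt 𝓘(ℝ, ℂ) x x)
      (g := fun p : EndE n × E n => p.1 p.2) h5 h4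
    rw [e] at this
    exact this
  have h2 := congrArg (fun L => L v) h3.mfderiv
  refine h2.trans ?_
  change P x (diff s x v) + diff P x v (s x) = _
  rw [add_comm]

/-- `connD` is the connection `π_V ∘ ∇ ∘ π_V + π_{V^⊥} ∘ ∇ ∘ π_{V^⊥}` on all sections. -/
theorem cov_connD {n : ℕ} (a : Form M (EndE n)) (V : M → Submodule ℂ (E n)) (s : M → E n) (x : M)
    (hP : MDifferentiableAt 𝓘(ℝ, ℂ) 𝓘(ℝ, EndE n) (projV V) x)
    (hs : MDifferentiableAt 𝓘(ℝ, ℂ) 𝓘(ℝ, E n) s x) (v : T x) :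
    cov (connD a V) s x v = projV V x (cov a (fun y => projV V y (s y)) x v)
      + (1 - projV V x) (cov a (fun y => (1 - projV V y) (s y)) x v) := by
  have hQ : MDifferentiableAt 𝓘(ℝ, ℂ) 𝓘(ℝ, EndE n) (fun y => 1 - projV V y) x :=
    mdifferentiableAt_const.sub hP
  have hproj : projV V x * projV V x = projV V x := by
    unfold projV orthProj
    split_ifs with h
    · ext1 w; simp
    · simp
  have hp : ∀ w, projV V x (projV V x w) = projV V x w := fun w => by
    exact congrArg (fun A : EndE n => A w) hproj
  change diff s x v + connD a V x v (s x) = projV V x (diff (fun y => projV V y (s y)) x v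
      + a x v (projV V x (s x))) + (1 - projV V x) (diff (fun y => (1 - projV V y) (s y)) x v
      + a x v ((1 - projV V x) (s x)))
  simp only [diff_clm_apply hP hs, diff_clm_apply hQ hs]
  change _ + ((projV V x) ((diff (projV V) x v : EndE n) (s x) + a x v (projV V x (s x)))
    + ((1 - projV V) x) ((diff (1 - projV V) x v : EndE n) (s x)
      + a x v (((1 - projV V) x) (s x)))) = _
  have e : (1 - projV V : M → EndE n) = fun y => 1 - projV V y := rfl
  simp only [e, map_add, sub_apply, one_apply_eq_self, map_sub, hp]
  abel

/-- The one-form `𝒩_V^∇ = ∇ - 𝒟_V^∇`. -/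
def formN {n : ℕ} (a : Form M (EndE n)) (V : M → Submodule ℂ (E n)) : Form M (EndE n) := fun x =>
  a x - connD a V x

/-- The connection
`∇_V^{t,q} = 𝒟_V + t⁻¹ 𝒩_V^{1,0} + t 𝒩_V^{0,1} + (t⁻² - 1) q^{1,0} + (t² - 1) q^{0,1}`
for `∇ = d + a` and a complex number `t ≠ 0`. -/
def loopConn {n : ℕ} (a : Form M (EndE n)) (V : M → Submodule ℂ (E n)) (q : Form M (EndE n))
    (t : ℂ) : Form M (EndE n) := fun x =>
  connD a V x + t⁻¹ • part10 (formN a V) x + t • part01 (formN a V) x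
    + ((t ^ 2)⁻¹ - 1) • part10 q x + (t ^ 2 - 1) • part01 q x

/-! ### Surfaces, central sphere congruences, constrained harmonicity -/

/-- `V` is `(q, ∇)`-constrained harmonic, for `∇ = d + a`: it is a non-degenerate bundle, `q` is a
one-form with values in `∧²V ⊕ ∧²V^⊥`, and `∇_V^{t,q}` is flat for each `t ≠ 0`. -/
def IsConstrainedHarmonic [IsManifold 𝓘(ℂ) ω M] {n : ℕ} (a q : Form M (EndE n))
    (V : M → Submodule ℂ (E n)) : Prop :=
  (∃ r, IsSubbundle r V) ∧ (∀ x, IsNondeg (V x)) ∧ SmoothForm q ∧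
  (∀ x v, q x v ∈ wedgeSq (V x) ⊔ wedgeSq (perp (V x))) ∧
  ∀ t : ℂ, t ≠ 0 → IsFlat (loopConn a V q t)

/-- The pair `(L10, L01)` is a (complexified) `∇`-surface, for `∇ = d + a`: isotropic bundles of
rank two, meeting in a bundle `Λ` of rank one, with `∇^{1,0} ΓΛ ⊂ Ω^{1,0}(L10)` and
`∇^{0,1} ΓΛ ⊂ Ω^{0,1}(L01)`. -/
def IsSurface {n : ℕ} (a : Form M (EndE n)) (L10 L01 : M → Submodule ℂ (E n)) : Prop :=
  IsSubbundle 2 L10 ∧ IsSubbundle 2 L01 ∧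
  (∀ x, IsIsotropic (L10 x)) ∧ (∀ x, IsIsotropic (L01 x)) ∧
  IsSubbundle 1 (fun x => L10 x ⊓ L01 x) ∧
  ∀ U s, IsSection (fun x => L10 x ⊓ L01 x) U s → ∀ x ∈ U, ∀ v : T x,
    part10 (cov a s) x v ∈ L10 x ∧ part01 (cov a s) x v ∈ L01 x

/-- `V` is a `∇`-central sphere congruence of `(L10, L01)`, for `∇ = d + a`. -/
def IsCentralSphereCongruence {n : ℕ} (a : Form M (EndE n)) (V L10 L01 : M → Submodule ℂ (E n)) :
    Prop :=
  IsSubbundle 4 V ∧ (∀ x, IsNondeg (V x)) ∧ (∀ x, L10 x ⊔ L01 x ≤ V x) ∧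
  (∀ x, ∀ v : T x, ∀ w ∈ L01 x, part10 (formN a V) x v w = 0) ∧
  (∀ x, ∀ v : T x, ∀ w ∈ L10 x, part01 (formN a V) x v w = 0)

/-- `(L10, L01)` is a `∇`-surface with `∇`-central sphere congruence `V`, where `V` is
`(q, ∇)`-constrained harmonic with `q^{1,0}` valued in `∧² L01` and `q^{0,1}` in `∧² L10`. -/
def IsConstrainedWillmoreVia [IsManifold 𝓘(ℂ) ω M] {n : ℕ} (a q : Form M (EndE n))
    (V L10 L01 : M → Submodule ℂ (E n)) : Prop :=
  IsSurface a L10 L01 ∧ IsCentralSphereCongruence a V L10 L01 ∧ IsConstrainedHarmonic a q V ∧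
  (∀ x v, part10 q x v ∈ wedgeSq (L01 x)) ∧ (∀ x v, part01 q x v ∈ wedgeSq (L10 x))

/-- `(L10, L01)` is a `q`-constrained Willmore surface with respect to `∇ = d + a`. -/
def IsConstrainedWillmore [IsManifold 𝓘(ℂ) ω M] {n : ℕ} (a q : Form M (EndE n))
    (L10 L01 : M → Submodule ℂ (E n)) : Prop :=
  ∃ V, IsConstrainedWillmoreVia a q V L10 L01

/-! ### Reality -/

/-- A bundle is real if it is invariant under complex conjugation. -/
def IsRealBundle {n : ℕ} (V : M → Submodule ℂ (E n)) : Prop :=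
  ∀ x, ∀ w ∈ V x, conjE w ∈ V x

/-- An endomorphism is real if it commutes with complex conjugation. -/
def IsRealEnd {n : ℕ} (A : EndE n) : Prop := ∀ w, A (conjE w) = conjE (A w)

/-- A one-form is real if it is valued in the real endomorphisms on (real) tangent vectors. -/
def IsRealForm {n : ℕ} (q : Form M (EndE n)) : Prop := ∀ x v, IsRealEnd (q x v)

/-- The surface `(L10, L01)` defines a real surface: `Λ = L10 ∩ L01` is a real null line bundle and
an immersion into the projectivised light-cone, that is, `Λ^(1) = ⟨σ, dσ(TM)⟩` has rank three for
each nowhere zero local section `σ` of `Λ`. -/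
def IsRealSurface {n : ℕ} (L10 L01 : M → Submodule ℂ (E n)) : Prop :=
  IsSurface 0 L10 L01 ∧ IsRealBundle (fun x => L10 x ⊓ L01 x) ∧
  ∀ U σ, IsSection (fun x => L10 x ⊓ L01 x) U σ → (∀ y ∈ U, σ y ≠ 0) → ∀ x ∈ U,
    Module.finrank ℂ
      (Submodule.span ℂ (insert (σ x) (Set.range fun v : T x => cov 0 σ x v))) = 3

/-- `(L10, L01)` is a real `q`-constrained Willmore surface. -/
def IsRealConstrainedWillmore [IsManifold 𝓘(ℂ) ω M] {n : ℕ} (q : Form M (EndE n))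
    (L10 L01 : M → Submodule ℂ (E n)) : Prop :=
  IsConstrainedWillmore 0 q L10 L01 ∧ IsRealSurface L10 L01 ∧ IsRealForm q

/-! ### The spectral deformation -/

/-- `φ` is an isometry of bundles from the trivial bundle with the connection `d + a` to the
trivial bundle with the connection `d + a'`, preserving connections. -/
def IsParallelIsometry {n : ℕ} (a a' : Form M (EndE n)) (φ : M → (E n ≃L[ℂ] E n)) : Prop :=
  SmoothOn (fun x => (φ x : EndE n)) Set.univ ∧
  (∀ x u w, bil n (φ x u) (φ x w) = bil n u w) ∧
  ∀ U : Set M, IsOpen U → ∀ s : M → E n, SmoothOn s U → ∀ x ∈ U, ∀ v : T x,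
    cov a' (fun y => φ y (s y)) x v = φ x (cov a s x v)

/-- The isometry `φ` is real. -/
def IsRealIso {n : ℕ} (φ : M → (E n ≃L[ℂ] E n)) : Prop := ∀ x, IsRealEnd (φ x : EndE n)

/-- The bundle `φ V`. -/
def mapBundle {n : ℕ} (φ : M → (E n ≃L[ℂ] E n)) (V : M → Submodule ℂ (E n)) :
    M → Submodule ℂ (E n) :=
  fun x => (V x).map (φ x).toLinearEquiv.toLinearMap

/-- `Ad_φ q = φ q φ⁻¹`. -/
def adForm {n : ℕ} (φ : M → (E n ≃L[ℂ] E n)) (q : Form M (EndE n)) : Form M (EndE n) := fun x =>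
  ((ContinuousLinearMap.compL ℂ (E n) (E n) (E n) (φ x : EndE n)).restrictScalars ℝ).comp
    ((((ContinuousLinearMap.compL ℂ (E n) (E n) (E n)).flip
      ((φ x).symm : EndE n)).restrictScalars ℝ).comp (q x))

/-- `q_t = t⁻² q^{1,0} + t² q^{0,1}`. -/
def qLam {n : ℕ} (q : Form M (EndE n)) (t : ℂ) : Form M (EndE n) := fun x =>
  (t ^ 2)⁻¹ • part10 q x + t ^ 2 • part01 q x

end Forms

end Willmore

end

open Willmore

namespace Willmore

/-! ### The complex structure, local vector fields and calculus on the surface -/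

section Forms

variable {M : Type*} [TopologicalSpace M] [ChartedSpace ℂ M]

/-! Write π for the projection onto V and N = N_V. Since d - N is the connection D_V, one has
d^{λ,q}_V = d + a with a = (λ⁻¹-1)N^{1,0} + (λ-1)N^{0,1} + (λ⁻²-1)q^{1,0} + (λ²-1)q^{0,1}, and a
parallel isometry is an isometric solution of dφ = φ a.

Part 1. Differentiating π_{φV} φ = φ π compares the second fundamental forms of φV and V. As q
commutes with π and N is off-diagonal, q drops out and N_{φV} = φ(λ⁻¹N^{1,0} + λN^{0,1})φ⁻¹
(`formN_mapBundle`). Hence φ intertwines the connection of V at λμ with that of φV, Ad_φ q_λ at μ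
(`loopConn_mapBundle`), and flatness for all μ is inherited (`IsFlat.of_intertwining`). The central
sphere conditions survive because the types of N are only rescaled. Finally N^{1,0} and q^{1,0} kill
Λ^{0,1}, and N^{0,1} and q^{0,1} kill Λ^{1,0}, so a vanishes on Λ: sections of Λ have the same
derivatives for d and d^{λ,q}_V, and the surface condition is transported by φ.

Part 2. For a real section σ of Λ, V is spanned by σ, its two first derivatives by type, and one
mixed second derivative; the conjugates of all four lie in V, so V is real
(`IsCentralSphereCongruence.isRealBundle`). Then a is real for |λ| = 1, because conjugation
exchanges both the types and λ with λ⁻¹. Normalising φ to be the identity at one point of each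
component makes it real, since φ conj φ⁻¹ is locally constant (`IsParallelIsometry.exists_real`).
The immersion condition involves only first derivatives of sections of Λ, so φ preserves it. -/

theorem J_J {x : M} (v : T x) : J x (J x v) = -v := by
  change Complex.I * (Complex.I * (show ℂ from v)) = -(show ℂ from v)
  rw [← mul_assoc, Complex.I_mul_I, neg_one_mul]

/-- The coordinates of the tangent bundle coming from a holomorphic chart are `J`-linear. -/
theorem trivializationAt_J [IsManifold 𝓘(ℂ) ω M] {x₀ y : M} (hy : y ∈ (chartAt ℂ x₀).source)
    (v : T y) :
    (trivializationAt ℂ (T (M := M)) x₀ ⟨y, J y v⟩).2 =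
      Complex.I • (trivializationAt ℂ (T (M := M)) x₀ ⟨y, v⟩).2 := by
  rw [TangentBundle.trivializationAt_apply, TangentBundle.trivializationAt_apply]
  have hz : extChartAt 𝓘(ℂ) y y ∈
      ((extChartAt 𝓘(ℂ) y).symm ≫ extChartAt 𝓘(ℂ) x₀).source := by
    simp [hy]
  -- The coordinate change is holomorphic, so its real derivative is the complex derivative with
  -- scalars restricted, and commutes with i.
  have h := (contDiffWithinAt_ext_coord_change (n := ω) x₀ y hz).differentiableWithinAt
    (by simp)
  rw [show Set.range 𝓘(ℂ) = Set.univ by simp, differentiableWithinAt_univ] at h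
  have h2 := h.fderiv_restrictScalars ℝ
  simp only [extChartAt] at h2
  have h3 (u : ℂ) : fderivWithin ℝ
      ((chartAt ℂ x₀).extend 𝓘(ℝ, ℂ) ∘ ((chartAt ℂ y).extend 𝓘(ℝ, ℂ)).symm)
      (Set.range 𝓘(ℝ, ℂ)) ((chartAt ℂ y).extend 𝓘(ℝ, ℂ) y) u =
      fderiv ℂ ((chartAt ℂ x₀).extend 𝓘(ℂ) ∘ ((chartAt ℂ y).extend 𝓘(ℂ)).symm)
        ((chartAt ℂ y).extend 𝓘(ℂ) y) u := by
    rw [show Set.range 𝓘(ℝ, ℂ) = Set.univ by simp, fderivWithin_univ]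
    exact congrArg (fun A => A u) h2
  refine (h3 (Complex.I • (show ℂ from v))).trans ?_
  refine Eq.trans ?_ (congrArg (fun z : ℂ => Complex.I • z) (h3 v)).symm
  exact ContinuousLinearMap.map_smul _ Complex.I (show ℂ from v)

/-- In holomorphic coordinates J is multiplication by the constant i. This is what makes the type
parts of a smooth form smooth. -/
theorem SmoothFieldOn.J [IsManifold 𝓘(ℂ) ω M] {X : (x : M) → T x} {U : Set M}
    (hX : SmoothFieldOn X U) : SmoothFieldOn (fun x => J x (X x)) U := by
  intro x₀ hx₀
  have h := hX x₀ hx₀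
  rw [Bundle.contMDiffWithinAt_section] at h ⊢
  have hI : ContDiff ℝ ∞ (fun z : ℂ => Complex.I • z) := by fun_prop
  have h2 := hI.comp_contMDiffWithinAt h
  refine h2.congr_of_eventuallyEq ?_ (trivializationAt_J (mem_chart_source ℂ x₀) _)
  filter_upwards [mem_nhdsWithin_of_mem_nhds ((chartAt ℂ x₀).open_source.mem_nhds
    (mem_chart_source ℂ x₀))] with y hy
  exact trivializationAt_J hy _

/-- Each tangent vector is the value of a smooth local vector field. -/
theorem exists_smoothFieldOn [IsManifold 𝓘(ℂ) ω M] (x₀ : M) :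
    ∃ (U : Set M) (X : (x : M) → T x), IsOpen U ∧ x₀ ∈ U ∧ SmoothFieldOn X U ∧ X x₀ ≠ 0 := by
  set e := trivializationAt ℂ (T (M := M)) x₀
  refine ⟨e.baseSet, e.localFrame Complex.basisOneI 0, e.open_baseSet,
    FiberBundle.mem_baseSet_trivializationAt' x₀, ?_, ?_⟩
  · exact e.contMDiffOn_localFrame_baseSet ∞ Complex.basisOneI 0
  · rw [e.localFrame_apply_of_mem_baseSet _ (FiberBundle.mem_baseSet_trivializationAt' x₀)]
    exact (e.basisAt Complex.basisOneI _).ne_zero 0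

section Calculus

variable {F : Type*} [NormedAddCommGroup F] [NormedSpace ℝ F]

theorem SmoothOn.mdifferentiableAt {s : M → F} {U : Set M} (hs : SmoothOn s U) (hU : IsOpen U)
    {x : M} (hx : x ∈ U) : MDifferentiableAt 𝓘(ℝ, ℂ) 𝓘(ℝ, F) s x :=
  (hs.contMDiffAt (hU.mem_nhds hx)).mdifferentiableAt (by simp)

theorem SmoothOn.diff_apply [IsManifold 𝓘(ℂ) ω M] {s : M → F} {U : Set M} (hU : IsOpen U)
    (hs : SmoothOn s U) {X : (x : M) → T x} (hX : SmoothFieldOn X U) :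
    SmoothOn (fun x => diff s x (X x)) U := by
  have : IsManifold 𝓘(ℝ, ℂ) 1 M := IsManifold.of_le (n := ω) le_top
  have h1 := ContMDiffOn.contMDiffOn_tangentMapWithin (m := ∞) hs (by simp) hU.uniqueMDiffOn
  have h2 := (contMDiff_snd_tangentBundle_modelSpace F 𝓘(ℝ, F) (n := ∞)).comp_contMDiffOn
    (h1.comp hX (fun x hx => hx))
  refine h2.congr fun x hx => ?_
  change mfderiv _ _ s x (X x) = mfderivWithin _ _ s U x (X x)
  rw [mfderivWithin_of_isOpen hU hx]

theorem diff_congr {f g : M → F} {U : Set M} (hU : IsOpen U) (h : ∀ y ∈ U, f y = g y) {x : M}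
    (hx : x ∈ U) : diff f x = diff g x :=
  Filter.EventuallyEq.mfderiv_eq (Filter.eventually_of_mem (hU.mem_nhds hx) h)

theorem diff_const (c : F) (x : M) : diff (fun _ : M => c) x = 0 := mfderiv_const

variable {G : Type*} [NormedAddCommGroup G] [NormedSpace ℝ G]

theorem SmoothOn.clm_comp {s : M → F} {U : Set M} (hs : SmoothOn s U) (L : F →L[ℝ] G) :
    SmoothOn (fun x => L (s x)) U :=
  L.contMDiff.comp_contMDiffOn hs

theorem diff_clm_comp {s : M → F} {x : M} (hs : MDifferentiableAt 𝓘(ℝ, ℂ) 𝓘(ℝ, F) s x)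
    (L : F →L[ℝ] G) (v : T x) : diff (fun y => L (s y)) x v = L (diff s x v) := by
  have h := L.hasMFDerivAt.comp x hs.hasMFDerivAt
  have h2 := congrArg (fun A => A v) h.mfderiv
  exact h2

theorem diff_add {s t : M → F} {x : M} (hs : MDifferentiableAt 𝓘(ℝ, ℂ) 𝓘(ℝ, F) s x)
    (ht : MDifferentiableAt 𝓘(ℝ, ℂ) 𝓘(ℝ, F) t x) (v : T x) :
    diff (fun y => s y + t y) x v = diff s x v + diff t x v :=
  congrArg (fun A => A v) (hs.hasMFDerivAt.add ht.hasMFDerivAt).mfderiv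

theorem SmoothOn.add {s t : M → F} {U : Set M} (hs : SmoothOn s U) (ht : SmoothOn t U) :
    SmoothOn (fun x => s x + t x) U := ContMDiffOn.add hs ht

theorem SmoothOn.const (c : F) (U : Set M) : SmoothOn (fun _ : M => c) U := contMDiffOn_const

theorem SmoothOn.mono {s : M → F} {U W : Set M} (hs : SmoothOn s U) (h : W ⊆ U) : SmoothOn s W :=
  ContMDiffOn.mono hs h

theorem SmoothOn.congr {s t : M → F} {U : Set M} (hs : SmoothOn s U) (h : ∀ x ∈ U, t x = s x) :
    SmoothOn t U := ContMDiffOn.congr hs h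

variable {H : Type*} [NormedAddCommGroup H] [NormedSpace ℝ H]

theorem SmoothOn.bilin {s : M → F} {t : M → G} {U : Set M} (hs : SmoothOn s U)
    (ht : SmoothOn t U) (B : F →L[ℝ] G →L[ℝ] H) : SmoothOn (fun x => B (s x) (t x)) U :=
  ContMDiffOn.clm_apply (hs.clm_comp B) ht

/-- Product rule for a bilinear map. -/
theorem diff_bilin {s : M → F} {t : M → G} {x : M}
    (hs : MDifferentiableAt 𝓘(ℝ, ℂ) 𝓘(ℝ, F) s x) (ht : MDifferentiableAt 𝓘(ℝ, ℂ) 𝓘(ℝ, G) t x)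
    (B : F →L[ℝ] G →L[ℝ] H) (v : T x) :
    diff (fun y => B (s y) (t y)) x v = B (diff s x v) (t x) + B (s x) (diff t x v) := by
  have h : HasMFDerivAt 𝓘(ℝ, ℂ) 𝓘(ℝ, H) (fun y => B (s y) (t y)) x
      (show ℂ →L[ℝ] H from B.precompR ℂ (s x) (show ℂ →L[ℝ] G from diff t x) +
        B.precompL ℂ (show ℂ →L[ℝ] F from diff s x) (t x)) := by
    refine ⟨(B.isBoundedBilinearMap.continuous.continuousAt.comp
      (hs.continuousAt.prodMk ht.continuousAt) :), ?_⟩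
    have h := B.hasFDerivWithinAt_of_bilinear hs.hasMFDerivAt.2 ht.hasMFDerivAt.2
    simp only [writtenInExtChartAt, extChartAt_model_space_eq_id, PartialEquiv.refl_coe,
      Function.comp_apply, id_eq, extChartAt_to_inv] at h
    exact h
  refine (congrArg (fun A => A v) h.mfderiv).trans (add_comm _ _)

end Calculus

end Forms

/-! ### Orthogonal projections, ∧² and isometries -/

section LinearAlgebra

variable {n : ℕ}

theorem bil_apply (u v : E n) : bil n u v =
    (∑ i : Fin (n + 1), u i.castSucc * v i.castSucc)
      - u (Fin.last (n + 1)) * v (Fin.last (n + 1)) := rfl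

theorem bil_comm (u v : E n) : bil n u v = bil n v u := by
  simp only [bil_apply, mul_comm]

theorem bil_isRefl (n : ℕ) : (bil n).IsRefl := fun u v h => by rw [bil_comm, h]

/-- Non-degeneracy is exactly the case in which `orthProj` is not its default value. -/
theorem isNondeg_iff {W : Submodule ℂ (E n)} : IsNondeg W ↔ IsCompl W (perp W) :=
  LinearMap.BilinForm.restrict_nondegenerate_iff_isCompl_orthogonal (bil_isRefl n)

theorem IsNondeg.eq_zero {W : Submodule ℂ (E n)} (hW : IsNondeg W) {w : E n} (hw : w ∈ W)
    (h : ∀ u ∈ W, bil n u w = 0) : w = 0 :=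
  Submodule.disjoint_def.1 (isNondeg_iff.1 hW).disjoint w hw h

theorem orthProj_mem (W : Submodule ℂ (E n)) (w : E n) : orthProj W w ∈ W := by
  unfold orthProj
  split_ifs with h
  · exact Submodule.projection_apply_mem h w
  · exact W.zero_mem

theorem orthProj_of_mem {W : Submodule ℂ (E n)} (hW : IsNondeg W) {w : E n} (hw : w ∈ W) :
    orthProj W w = w := by
  unfold orthProj
  rw [dif_pos (isNondeg_iff.1 hW)]
  exact Submodule.projection_apply_of_mem_left _ hw

theorem orthProj_of_mem_perp {W : Submodule ℂ (E n)} (hW : IsNondeg W) {w : E n}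
    (hw : w ∈ perp W) : orthProj W w = 0 := by
  unfold orthProj
  rw [dif_pos (isNondeg_iff.1 hW)]
  exact (Submodule.projection_apply_eq_zero_iff _).2 hw

/-- Uniqueness of the orthogonal decomposition. It identifies the projection after an isometry, in
terms of a frame, and under conjugation. -/
theorem orthProj_eq {W : Submodule ℂ (E n)} (hW : IsNondeg W) {p w : E n} (hp : p ∈ W)
    (hw : w - p ∈ perp W) : orthProj W w = p := by
  have h := orthProj_of_mem_perp hW hw
  rwa [map_sub, orthProj_of_mem hW hp, sub_eq_zero] at h

theorem sub_orthProj_mem {W : Submodule ℂ (E n)} (hW : IsNondeg W) (w : E n) :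
    w - orthProj W w ∈ perp W := by
  obtain ⟨p, hp, r, hr, rfl⟩ := Submodule.mem_sup.1
    ((isNondeg_iff.1 hW).sup_eq_top ▸ Submodule.mem_top (x := w))
  rw [map_add, orthProj_of_mem hW hp, orthProj_of_mem_perp hW hr, add_zero, add_sub_cancel_left]
  exact hr

theorem orthProj_orthProj (W : Submodule ℂ (E n)) (w : E n) :
    orthProj W (orthProj W w) = orthProj W w := by
  unfold orthProj
  split_ifs with h
  · simp
  · simp

theorem wedge_apply (u v w : E n) : wedge u v w = bil n u w • v - bil n v w • u := rfl

theorem wedgeSq_mono {W W' : Submodule ℂ (E n)} (h : W ≤ W') : wedgeSq W ≤ wedgeSq W' :=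
  Submodule.span_mono fun _ ⟨u, hu, v, hv, e⟩ => ⟨u, h hu, v, h hv, e⟩

theorem wedgeSq_apply_mem {W : Submodule ℂ (E n)} {A : EndE n} (hA : A ∈ wedgeSq W) (w : E n) :
    A w ∈ W := by
  induction hA using Submodule.span_induction with
  | mem A h =>
    obtain ⟨u, hu, v, hv, rfl⟩ := h
    exact W.sub_mem (W.smul_mem _ hv) (W.smul_mem _ hu)
  | zero => exact W.zero_mem
  | add A B _ _ hA hB => exact W.add_mem hA hB
  | smul c A _ hA => exact W.smul_mem c hA

/-- Serves two ways: for isotropic W, ∧²W annihilates W itself, so q^{1,0} kills Λ^{0,1}; for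
non-degenerate W, ∧²W annihilates W^⊥. -/
theorem wedgeSq_apply_eq_zero {W : Submodule ℂ (E n)} {A : EndE n} (hA : A ∈ wedgeSq W) {w : E n}
    (hw : ∀ u ∈ W, bil n u w = 0) : A w = 0 := by
  induction hA using Submodule.span_induction with
  | mem A h =>
    obtain ⟨u, hu, v, hv, rfl⟩ := h
    rw [wedge_apply, hw u hu, hw v hv, zero_smul, zero_smul, sub_zero]
  | zero => rfl
  | add A B _ _ hA hB => rw [add_apply, hA, hB, add_zero]
  | smul c A _ hA => rw [smul_apply, hA, smul_zero]

/-- An endomorphism in `∧²W ⊕ ∧²W^⊥` commutes with the projection onto `W`. -/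
theorem commute_orthProj {W : Submodule ℂ (E n)} (hW : IsNondeg W) {A : EndE n}
    (hA : A ∈ wedgeSq W ⊔ wedgeSq (perp W)) : orthProj W * A = A * orthProj W := by
  obtain ⟨B, hB, C, hC, rfl⟩ := Submodule.mem_sup.1 hA
  ext1 w
  have h1 := sub_orthProj_mem hW w
  have h2 : C (orthProj W w) = 0 := wedgeSq_apply_eq_zero hC fun u hu => by
    rw [bil_comm]; exact hu _ (orthProj_mem W w)
  have h3 : B w = B (orthProj W w) := by
    rw [← sub_eq_zero, ← map_sub]
    exact wedgeSq_apply_eq_zero hB h1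
  change orthProj W (B w + C w) = B (orthProj W w) + C (orthProj W w)
  rw [map_add, orthProj_of_mem hW (wedgeSq_apply_mem hB w),
    orthProj_of_mem_perp hW (wedgeSq_apply_mem hC w), h2, h3]

/-! ### Isometries -/

variable {f : E n ≃L[ℂ] E n}

theorem isNondeg_map (hf : ∀ u w, bil n (f u) (f w) = bil n u w) {W : Submodule ℂ (E n)}
    (hW : IsNondeg W) : IsNondeg (W.map f.toLinearEquiv.toLinearMap) := by
  rw [isNondeg_iff]
  refine (LinearMap.BilinForm.isCompl_orthogonal_iff_disjoint (bil_isRefl n)).2 ?_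
  rw [Submodule.disjoint_def]
  rintro _ ⟨w, hw, rfl⟩ hx
  have : w = 0 := hW.eq_zero hw fun u hu => (hf u w).symm.trans (hx _ ⟨u, hu, rfl⟩)
  rw [this, map_zero]

theorem perp_map (hf : ∀ u w, bil n (f u) (f w) = bil n u w) (W : Submodule ℂ (E n)) :
    perp (W.map f.toLinearEquiv.toLinearMap) = (perp W).map f.toLinearEquiv.toLinearMap := by
  ext w
  constructor
  · intro hw
    refine ⟨f.symm w, fun u hu => ?_, f.apply_symm_apply w⟩
    refine (hf u _).symm.trans ?_
    rw [f.apply_symm_apply]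
    exact hw _ ⟨u, hu, rfl⟩
  · rintro ⟨w, hw, rfl⟩ _ ⟨u, hu, rfl⟩
    exact (hf u w).trans (hw u hu)

theorem orthProj_map (hf : ∀ u w, bil n (f u) (f w) = bil n u w) {W : Submodule ℂ (E n)}
    (hW : IsNondeg W) (w : E n) :
    orthProj (W.map f.toLinearEquiv.toLinearMap) (f w) = f (orthProj W w) := by
  refine orthProj_eq (isNondeg_map hf hW) ⟨_, orthProj_mem W w, rfl⟩ ?_
  rw [perp_map hf, ← map_sub]
  exact ⟨_, sub_orthProj_mem hW w, rfl⟩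

/-- An isometry satisfies f (u ∧ v) f⁻¹ = fu ∧ fv. -/
theorem wedgeSq_map (hf : ∀ u w, bil n (f u) (f w) = bil n u w) {W : Submodule ℂ (E n)}
    {A : EndE n} (hA : A ∈ wedgeSq W) :
    (f : EndE n) * A * (f.symm : EndE n) ∈ wedgeSq (W.map f.toLinearEquiv.toLinearMap) := by
  induction hA using Submodule.span_induction with
  | mem A h =>
    obtain ⟨u, hu, v, hv, rfl⟩ := h
    refine Submodule.subset_span ⟨f u, ⟨u, hu, rfl⟩, f v, ⟨v, hv, rfl⟩, ?_⟩
    ext1 w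
    change f (wedge u v (f.symm w)) = wedge (f u) (f v) w
    obtain ⟨w, rfl⟩ := f.surjective w
    rw [wedge_apply, wedge_apply, hf, hf, f.symm_apply_apply, map_sub, map_smul, map_smul]
  | zero => rw [mul_zero, zero_mul]; exact Submodule.zero_mem _
  | add A B _ _ hA hB => rw [mul_add, add_mul]; exact Submodule.add_mem _ hA hB
  | smul c A _ hA =>
    have : (f : EndE n) * (c • A) * (f.symm : EndE n) = c • ((f : EndE n) * A * f.symm) := by
      ext1 w
      exact f.map_smul c _
    rw [this]
    exact Submodule.smul_mem _ c hA

theorem isIsotropic_map (hf : ∀ u w, bil n (f u) (f w) = bil n u w) {W : Submodule ℂ (E n)}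
    (hW : IsIsotropic W) : IsIsotropic (W.map f.toLinearEquiv.toLinearMap) := by
  rintro _ ⟨u, hu, rfl⟩ _ ⟨w, hw, rfl⟩
  exact (hf u w).trans (hW u hu w hw)

end LinearAlgebra

/-! ### Smoothness of the projection field -/

section Frames

variable {n r : ℕ}

/-- The linear map `c ↦ ∑ cᵢ sᵢ`. -/
noncomputable def frameMap : (Fin r → E n) →L[ℂ] (Fin r → ℂ) →L[ℂ] E n :=
  LinearMap.toContinuousBilinearMap <| LinearMap.mk₂ ℂ (fun s c => ∑ i, c i • s i)
    (by intros; simp only [Pi.add_apply, smul_add, Finset.sum_add_distrib])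
    (by intro c s d; simp only [Pi.smul_apply, Finset.smul_sum, smul_comm c])
    (by intros; simp only [Pi.add_apply, add_smul, Finset.sum_add_distrib])
    (by intros; simp only [Pi.smul_apply, Finset.smul_sum, smul_eq_mul, mul_smul])

/-- The linear map `w ↦ ((sᵢ, w))ᵢ`. -/
noncomputable def frameDual : (Fin r → E n) →L[ℂ] E n →L[ℂ] (Fin r → ℂ) :=
  LinearMap.toContinuousBilinearMap <| LinearMap.mk₂ ℂ (fun s w i => bil n (s i) w)
    (by intros; ext; simp) (by intros; ext; simp) (by intros; ext; simp) (by intros; ext; simp)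

/-- The orthogonal projection onto the span of a frame, in terms of the inverse Gram matrix. -/
noncomputable def frameProj (s : Fin r → E n) : EndE n :=
  (frameMap s).comp ((((frameDual s).comp (frameMap s)).inverse).comp (frameDual s))

theorem frameMap_apply (s : Fin r → E n) (c : Fin r → ℂ) : frameMap s c = ∑ i, c i • s i := rfl

variable {s : Fin r → E n}

theorem frameMap_mem (c : Fin r → ℂ) :
    frameMap s c ∈ Submodule.span ℂ (Set.range s) := by
  rw [frameMap_apply]
  exact Submodule.sum_mem _ fun i _ => Submodule.smul_mem _ _
    (Submodule.subset_span (Set.mem_range_self i))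

theorem frameDual_eq_zero {w : E n} (hw : frameDual s w = 0) :
    w ∈ perp (Submodule.span ℂ (Set.range s)) := by
  intro u hu
  change bil n u w = 0
  induction hu using Submodule.span_induction with
  | mem u h => obtain ⟨i, rfl⟩ := h; exact congrFun hw i
  | zero => rw [map_zero, LinearMap.zero_apply]
  | add u v _ _ hu hv => rw [map_add, LinearMap.add_apply, hu, hv, add_zero]
  | smul c u _ hu => rw [map_smul, LinearMap.smul_apply, hu, smul_zero]

/-- A null vector of the Gram matrix is the coordinate vector of an element of W ∩ W^⊥ = 0. -/
theorem isInvertible_gram (hs : LinearIndependent ℂ s)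
    (hW : IsNondeg (Submodule.span ℂ (Set.range s))) :
    ((frameDual s).comp (frameMap s)).IsInvertible := by
  have hinj : Function.Injective ((frameDual s).comp (frameMap s)).toLinearMap := by
    rw [injective_iff_map_eq_zero]
    intro c hc
    have h := hW.eq_zero (frameMap_mem c) (frameDual_eq_zero hc)
    exact funext (Fintype.linearIndependent_iff.1 hs c h)
  exact ⟨(LinearEquiv.ofInjectiveEndo _ hinj).toContinuousLinearEquiv, by ext1; rfl⟩

theorem frameProj_eq (hs : LinearIndependent ℂ s)
    (hW : IsNondeg (Submodule.span ℂ (Set.range s))) :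
    orthProj (Submodule.span ℂ (Set.range s)) = frameProj s := by
  ext1 w
  refine orthProj_eq hW (frameMap_mem _) (frameDual_eq_zero ?_)
  rw [map_sub, sub_eq_zero]
  exact (congrArg (fun A => A (frameDual s w)) (isInvertible_gram hs hW).self_comp_inverse).symm

/-- Operator inversion is smooth at invertible operators, so the Gram formula is smooth in the frame
near an independent frame with non-degenerate span. -/
theorem contDiffAt_frameProj (hs : LinearIndependent ℂ s)
    (hW : IsNondeg (Submodule.span ℂ (Set.range s))) :
    ContDiffAt ℝ ∞ (frameProj : (Fin r → E n) → EndE n) s := by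
  have h1 : ContDiffAt ℂ ∞ (fun s : Fin r → E n => frameMap s) s := by fun_prop
  have h2 : ContDiffAt ℂ ∞ (fun s : Fin r → E n => frameDual s) s := by fun_prop
  have h3 := ((isInvertible_gram hs hW).contDiffAt_map_inverse (n := ∞)).comp s (h2.clm_comp h1)
  exact (h1.clm_comp (h3.clm_comp h2)).restrict_scalars ℝ

variable {M : Type*} [TopologicalSpace M] [ChartedSpace ℂ M]

theorem SmoothOn.pi {r : ℕ} {F : Type*} [NormedAddCommGroup F] [NormedSpace ℝ F]
    {s : Fin r → M → F} {U : Set M} (hs : ∀ i, SmoothOn (s i) U) :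
    SmoothOn (fun y i => s i y) U :=
  contMDiffOn_pi_space.2 hs

/-- The field of orthogonal projections onto a non-degenerate bundle is smooth. -/
theorem smoothOn_projV {V : M → Submodule ℂ (E n)} (hV : IsSubbundle r V)
    (hnd : ∀ x, IsNondeg (V x)) : SmoothOn (projV V) Set.univ := by
  intro x _
  obtain ⟨U, hU, hx, s, hs, hsp⟩ := hV x
  obtain ⟨hli, hspan⟩ := hsp x hx
  have h1 := (contDiffAt_frameProj hli (hspan ▸ hnd x)).comp_contMDiffAt
    ((SmoothOn.pi hs).contMDiffAt (hU.mem_nhds hx))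
  refine (h1.congr_of_eventuallyEq ?_).contMDiffWithinAt
  filter_upwards [hU.mem_nhds hx] with y hy
  obtain ⟨hli, hspan⟩ := hsp y hy
  change orthProj (V y) = frameProj fun i => s i y
  rw [hspan]
  exact frameProj_eq hli (hspan ▸ hnd y)

theorem SmoothOn.symm {φ : M → (E n ≃L[ℂ] E n)} {U : Set M}
    (hφ : SmoothOn (fun x => (φ x : EndE n)) U) :
    SmoothOn (fun x => ((φ x).symm : EndE n)) U := by
  intro x hx
  have h0 : ContDiffAt ℝ ∞ (ContinuousLinearMap.inverse : EndE n → EndE n) (φ x : EndE n) :=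
    (contDiffAt_map_inverse (𝕜 := ℂ) (n := ∞) (φ x)).restrict_scalars ℝ
  have h := h0.comp_contMDiffWithinAt (f := fun x => (φ x : EndE n)) (x := x) (hφ x hx)
  refine h.congr (fun y _ => ?_) ?_
  · exact (ContinuousLinearMap.inverse_equiv (φ y)).symm
  · exact (ContinuousLinearMap.inverse_equiv (φ x)).symm

/-- Application of endomorphisms, as a real bilinear map. -/
noncomputable def evalL (n : ℕ) : EndE n →L[ℝ] E n →L[ℝ] E n :=
  (ContinuousLinearMap.id ℂ (EndE n)).bilinearRestrictScalars ℝ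

/-- Composition of endomorphisms, as a real bilinear map. -/
noncomputable def mulL (n : ℕ) : EndE n →L[ℝ] EndE n →L[ℝ] EndE n :=
  (ContinuousLinearMap.compL ℂ (E n) (E n) (E n)).bilinearRestrictScalars ℝ

/-- The metric, as a real bilinear map. -/
noncomputable def bilL (n : ℕ) : E n →L[ℝ] E n →L[ℝ] ℂ :=
  (bil n).toContinuousBilinearMap.bilinearRestrictScalars ℝ

theorem SmoothOn.eval {A : M → EndE n} {s : M → E n} {U : Set M} (hA : SmoothOn A U)
    (hs : SmoothOn s U) : SmoothOn (fun x => A x (s x)) U := hA.bilin hs (evalL n)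

theorem SmoothOn.mul {A B : M → EndE n} {U : Set M} (hA : SmoothOn A U)
    (hB : SmoothOn B U) : SmoothOn (fun x => A x * B x) U := SmoothOn.bilin hA hB (mulL n)

theorem SmoothOn.const_smul {F : Type*} [NormedAddCommGroup F] [NormedSpace ℝ F] [NormedSpace ℂ F]
    [SMulCommClass ℝ ℂ F] {s : M → F} {U : Set M} (hs : SmoothOn s U) (c : ℂ) :
    SmoothOn (fun x => c • s x) U :=
  hs.clm_comp (c • ContinuousLinearMap.id ℝ F)

theorem diff_bil {s t : M → E n} {x : M} (hs : MDifferentiableAt 𝓘(ℝ, ℂ) 𝓘(ℝ, E n) s x)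
    (ht : MDifferentiableAt 𝓘(ℝ, ℂ) 𝓘(ℝ, E n) t x) (v : T x) :
    diff (fun y => bil n (s y) (t y)) x v =
      bil n (diff s x v) (t x) + bil n (s x) (diff t x v) :=
  diff_bilin hs ht (bilL n) v

/-- The image of a bundle under a smooth field of isomorphisms. -/
theorem IsSubbundle.map {V : M → Submodule ℂ (E n)} (hV : IsSubbundle r V)
    {φ : M → (E n ≃L[ℂ] E n)} (hφ : SmoothOn (fun x => (φ x : EndE n)) Set.univ) :
    IsSubbundle r (mapBundle φ V) := by
  intro x
  obtain ⟨U, hU, hx, s, hs, hsp⟩ := hV x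
  refine ⟨U, hU, hx, fun i y => φ y (s i y),
    fun i => (hφ.mono (Set.subset_univ U)).eval (hs i), fun y hy => ?_⟩
  obtain ⟨hli, hspan⟩ := hsp y hy
  refine ⟨hli.map' (φ y).toLinearEquiv.toLinearMap (φ y).toLinearEquiv.ker, ?_⟩
  change (V y).map (φ y).toLinearEquiv.toLinearMap = _
  rw [hspan, Submodule.map_span, ← Set.range_comp]
  rfl

end Frames

/-! ### Type decomposition and the second fundamental form -/

section FormAlgebra

variable {M : Type*} [TopologicalSpace M] [ChartedSpace ℂ M]

section Parts

variable {F : Type*} [NormedAddCommGroup F] [NormedSpace ℝ F] [NormedSpace ℂ F]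
  [SMulCommClass ℝ ℂ F] (α : Form M F) (x : M) (v : T x)

theorem part10_apply : part10 α x v = (1 / 2 : ℂ) • (α x v - Complex.I • α x (J x v)) := rfl

theorem part01_apply : part01 α x v = (1 / 2 : ℂ) • (α x v + Complex.I • α x (J x v)) := rfl

theorem part10_add_part01 : part10 α x v + part01 α x v = α x v := by
  rw [part10_apply, part01_apply]
  module

/-- Follows from J² = -1 and i² = -1. With its (0,1) companion it gives the eigenvalues ±i by which
types are recognised. -/
theorem part10_J : part10 α x (J x v) = Complex.I • part10 α x v := by
  rw [part10_apply, part10_apply, J_J, map_neg]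
  match_scalars <;> first
    | ring1
    | linear_combination (1 / 2 : ℂ) * Complex.I_mul_I

theorem part01_J : part01 α x (J x v) = -(Complex.I • part01 α x v) := by
  rw [part01_apply, part01_apply, J_J, map_neg]
  match_scalars <;> first
    | ring1
    | linear_combination (1 / 2 : ℂ) * Complex.I_mul_I

end Parts

variable {n : ℕ}

theorem part10_apply_apply (α : Form M (EndE n)) (x : M) (v : T x) (w : E n) :
    part10 α x v w = (1 / 2 : ℂ) • (α x v w - Complex.I • α x (J x v) w) := rfl

theorem part01_apply_apply (α : Form M (EndE n)) (x : M) (v : T x) (w : E n) :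
    part01 α x v w = (1 / 2 : ℂ) • (α x v w + Complex.I • α x (J x v) w) := rfl

theorem part10_J_apply (α : Form M (EndE n)) (x : M) (v : T x) (w : E n) :
    part10 α x (J x v) w = Complex.I • part10 α x v w := by
  rw [part10_J]; rfl

theorem part01_J_apply (α : Form M (EndE n)) (x : M) (v : T x) (w : E n) :
    part01 α x (J x v) w = -(Complex.I • part01 α x v w) := by
  rw [part01_J]; rfl

theorem part10_add_part01_apply (α : Form M (EndE n)) (x : M) (v : T x) (w : E n) :
    part10 α x v w + part01 α x v w = α x v w := by
  rw [← add_apply, part10_add_part01]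

/-- A decomposition into a complex linear and a complex antilinear part is the type
decomposition. -/
theorem part10_apply_eq {α : Form M (EndE n)} {x : M} {v : T x} {w : E n} {A B : T x → E n}
    (h : ∀ v, α x v w = A v + B v)
    (hA : ∀ v, A (J x v) = Complex.I • A v) (hB : ∀ v, B (J x v) = -(Complex.I • B v)) :
    part10 α x v w = A v := by
  rw [part10_apply_apply, h, h, hA, hB]
  match_scalars <;> first
    | ring1
    | linear_combination (1 / 2 : ℂ) * Complex.I_mul_I
    | linear_combination (-1 / 2 : ℂ) * Complex.I_mul_I

theorem part01_apply_eq {α : Form M (EndE n)} {x : M} {v : T x} {w : E n} {A B : T x → E n}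
    (h : ∀ v, α x v w = A v + B v)
    (hA : ∀ v, A (J x v) = Complex.I • A v) (hB : ∀ v, B (J x v) = -(Complex.I • B v)) :
    part01 α x v w = B v := by
  have h1 := part10_add_part01_apply α x v w
  rw [part10_apply_eq h hA hB, h] at h1
  exact add_left_cancel h1

theorem cov_apply (a : Form M (EndE n)) (s : M → E n) (x : M) (v : T x) :
    cov a s x v = diff s x v + a x v (s x) := rfl

theorem cov_zero (s : M → E n) : cov 0 s = diff s := by
  funext x
  ext1 v
  exact add_zero _

theorem part10_cov (a : Form M (EndE n)) (s : M → E n) (x : M) (v : T x) :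
    part10 (cov a s) x v = part10 (diff s) x v + part10 a x v (s x) := by
  rw [part10_apply, part10_apply, part10_apply_apply, cov_apply, cov_apply]
  module

theorem part01_cov (a : Form M (EndE n)) (s : M → E n) (x : M) (v : T x) :
    part01 (cov a s) x v = part01 (diff s) x v + part01 a x v (s x) := by
  rw [part01_apply, part01_apply, part01_apply_apply, cov_apply, cov_apply]
  module

theorem qLam_apply (q : Form M (EndE n)) (t : ℂ) (x : M) (v : T x) (w : E n) :
    qLam q t x v w = (t ^ 2)⁻¹ • part10 q x v w + t ^ 2 • part01 q x v w := rfl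

theorem adForm_apply_map (φ : M → (E n ≃L[ℂ] E n)) (q : Form M (EndE n)) (x : M) (v : T x)
    (u : E n) : adForm φ q x v (φ x u) = φ x (q x v u) := by
  change φ x (q x v ((φ x).symm (φ x u))) = _
  rw [(φ x).symm_apply_apply]

/-- Conjugation by the complex linear φ preserves types. Evaluating on φ u keeps φ⁻¹ out of the
formula. -/
theorem part10_adForm_qLam_map (φ : M → (E n ≃L[ℂ] E n)) (q : Form M (EndE n)) (t : ℂ) (x : M)
    (v : T x) (u : E n) :
    part10 (adForm φ (qLam q t)) x v (φ x u) = φ x ((t ^ 2)⁻¹ • part10 q x v u) := by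
  refine part10_apply_eq (A := fun v => φ x ((t ^ 2)⁻¹ • part10 q x v u))
    (B := fun v => φ x (t ^ 2 • part01 q x v u)) (fun v => ?_) (fun v => ?_) (fun v => ?_)
  · rw [adForm_apply_map, qLam_apply, map_add]
  · rw [part10_J_apply, smul_comm, map_smul]
  · rw [part01_J_apply, smul_neg, smul_comm, map_neg, map_smul]

theorem part01_adForm_qLam_map (φ : M → (E n ≃L[ℂ] E n)) (q : Form M (EndE n)) (t : ℂ) (x : M)
    (v : T x) (u : E n) :
    part01 (adForm φ (qLam q t)) x v (φ x u) = φ x (t ^ 2 • part01 q x v u) := by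
  refine part01_apply_eq (A := fun v => φ x ((t ^ 2)⁻¹ • part10 q x v u))
    (B := fun v => φ x (t ^ 2 • part01 q x v u)) (fun v => ?_) (fun v => ?_) (fun v => ?_)
  · rw [adForm_apply_map, qLam_apply, map_add]
  · rw [part10_J_apply, smul_comm, map_smul]
  · rw [part01_J_apply, smul_neg, smul_comm, map_neg, map_smul]

/-! ### The connections `𝒟_V` and `∇_V^{t,q}` -/

variable {V : M → Submodule ℂ (E n)}

omit [TopologicalSpace M] [ChartedSpace ℂ M] in
theorem projV_projV (x : M) (w : E n) : projV V x (projV V x w) = projV V x w :=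
  orthProj_orthProj _ _

theorem diff_clm_apply_const {P : M → EndE n} {x : M}
    (hP : MDifferentiableAt 𝓘(ℝ, ℂ) 𝓘(ℝ, EndE n) P x) (v : T x) (w : E n) :
    diff (fun y => P y w) x v = diff P x v w :=
  diff_clm_comp hP ((evalL n).flip w) v

variable {x : M} (hP : MDifferentiableAt 𝓘(ℝ, ℂ) 𝓘(ℝ, EndE n) (projV V) x)
include hP

/-- On constant sections D_V acts by π dπ - (1-π) dπ, because d(1-π) = -dπ. Hence N = (1-2π) dπ. -/
theorem formN_apply (v : T x) (w : E n) :
    formN 0 V x v w = diff (projV V) x v w - (2 : ℂ) • projV V x (diff (projV V) x v w) := by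
  have h1 : diff (F := EndE n) (1 - projV V) x v w = - diff (projV V) x v w := by
    have e : (1 - projV V : M → EndE n) = fun y => 1 + (-ContinuousLinearMap.id ℝ (EndE n)) (projV V y) := by
      funext y
      exact sub_eq_add_neg _ _
    have h2 := diff_clm_comp hP (-ContinuousLinearMap.id ℝ (EndE n)) v
    have h3 := diff_add (s := fun _ : M => (1 : EndE n)) mdifferentiableAt_const
      ((-ContinuousLinearMap.id ℝ (EndE n)).mdifferentiableAt.comp x hP) v
    rw [e]
    refine (congrArg (fun A : EndE n => A w) h3).trans ?_
    rw [diff_const]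
    refine (congrArg (fun A : EndE n => A w) (zero_add _)).trans ?_
    exact congrArg (fun A : EndE n => A w) h2
  have h : formN 0 V x v w = 0 - (projV V x (diff (projV V) x v w + 0)
      + (1 - projV V x) (diff (F := EndE n) (1 - projV V) x v w + 0)) := rfl
  rw [h, h1, sub_apply, one_apply_eq_self, add_zero, add_zero, map_neg]
  module

/-- The derivative of π² = π. -/
theorem diff_projV (v : T x) (w : E n) :
    diff (projV V) x v (projV V x w) + projV V x (diff (projV V) x v w)
      = diff (projV V) x v w := by
  have hw : MDifferentiableAt 𝓘(ℝ, ℂ) 𝓘(ℝ, E n) (fun y => projV V y w) x :=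
    ((evalL n).flip w).mdifferentiableAt.comp x hP
  have h1 := diff_clm_apply hP hw v
  rw [diff_clm_apply_const hP] at h1
  rw [← h1, ← diff_clm_apply_const hP]
  simp only [projV_projV]

end FormAlgebra

/-! ### The loop of connections -/

section LoopConnections

variable {M : Type*} [TopologicalSpace M] [ChartedSpace ℂ M] {n : ℕ}
  {V : M → Submodule ℂ (E n)} {q : Form M (EndE n)}

/-- `𝒩_V` takes values in the endomorphisms exchanging `V` and `V^⊥`. -/
theorem formN_projV {x : M} (hP : MDifferentiableAt 𝓘(ℝ, ℂ) 𝓘(ℝ, EndE n) (projV V) x) (v : T x)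
    (w : E n) :
    formN 0 V x v (projV V x w) + projV V x (formN 0 V x v w) = formN 0 V x v w := by
  have h1 := diff_projV hP v w
  -- Applying π to dπ π + π dπ = dπ leaves π dπ π = 0.
  have h2 : projV V x (diff (projV V) x v (projV V x w)) = 0 := by
    have := congrArg (projV V x) h1
    rwa [map_add, projV_projV, add_eq_right] at this
  have h3 : diff (projV V) x v (projV V x w)
      = diff (projV V) x v w - projV V x (diff (projV V) x v w) := eq_sub_of_add_eq h1
  rw [formN_apply hP, formN_apply hP, h2, h3, map_sub, map_smul, projV_projV]
  module

theorem part10_formN_projV {x : M} (hP : MDifferentiableAt 𝓘(ℝ, ℂ) 𝓘(ℝ, EndE n) (projV V) x)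
    (v : T x) (w : E n) :
    part10 (formN 0 V) x v (projV V x w) + projV V x (part10 (formN 0 V) x v w)
      = part10 (formN 0 V) x v w := by
  have h1 := formN_projV hP v w
  have h2 := formN_projV hP (J x v) w
  rw [part10_apply_apply, part10_apply_apply, map_smul, map_sub, map_smul]
  linear_combination (norm := module) (1 / 2 : ℂ) • h1 - (Complex.I / 2) • h2

theorem part01_formN_projV {x : M} (hP : MDifferentiableAt 𝓘(ℝ, ℂ) 𝓘(ℝ, EndE n) (projV V) x)
    (v : T x) (w : E n) :
    part01 (formN 0 V) x v (projV V x w) + projV V x (part01 (formN 0 V) x v w)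
      = part01 (formN 0 V) x v w := by
  have h1 := formN_projV hP v w
  have h2 := formN_projV hP (J x v) w
  rw [part01_apply_apply, part01_apply_apply, map_smul, map_add, map_smul]
  linear_combination (norm := module) (1 / 2 : ℂ) • h1 + (Complex.I / 2) • h2

/-- For the trivial connection D_V = d - N, which turns the coefficients λ^{∓1} of N into λ^{∓1} -
1. In this form every term is a tensor of definite type. -/
theorem loopConn_apply (t : ℂ) (x : M) (v : T x) (w : E n) :
    loopConn 0 V q t x v w = (t⁻¹ - 1) • part10 (formN 0 V) x v w
      + (t - 1) • part01 (formN 0 V) x v w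
      + ((t ^ 2)⁻¹ - 1) • part10 q x v w + (t ^ 2 - 1) • part01 q x v w := by
  have h : connD 0 V x v w = -(part10 (formN 0 V) x v w + part01 (formN 0 V) x v w) := by
    rw [part10_add_part01_apply]
    change _ = -(0 - connD 0 V x v w)
    rw [zero_sub, neg_neg]
  change connD 0 V x v w + t⁻¹ • part10 (formN 0 V) x v w + t • part01 (formN 0 V) x v w
    + ((t ^ 2)⁻¹ - 1) • part10 q x v w + (t ^ 2 - 1) • part01 q x v w = _
  rw [h]
  module

theorem part10_loopConn_apply (t : ℂ) (x : M) (v : T x) (w : E n) :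
    part10 (loopConn 0 V q t) x v w = (t⁻¹ - 1) • part10 (formN 0 V) x v w
      + ((t ^ 2)⁻¹ - 1) • part10 q x v w := by
  refine part10_apply_eq (A := fun v => (t⁻¹ - 1) • part10 (formN 0 V) x v w
      + ((t ^ 2)⁻¹ - 1) • part10 q x v w) (B := fun v => (t - 1) • part01 (formN 0 V) x v w
      + (t ^ 2 - 1) • part01 q x v w) (fun v => ?_) (fun v => ?_) (fun v => ?_)
  · rw [loopConn_apply]; module
  · rw [part10_J_apply, part10_J_apply]; module
  · rw [part01_J_apply, part01_J_apply]; module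

theorem part01_loopConn_apply (t : ℂ) (x : M) (v : T x) (w : E n) :
    part01 (loopConn 0 V q t) x v w = (t - 1) • part01 (formN 0 V) x v w
      + (t ^ 2 - 1) • part01 q x v w := by
  have h := part10_add_part01_apply (loopConn 0 V q t) x v w
  rw [part10_loopConn_apply, loopConn_apply] at h
  rw [← sub_eq_zero] at h ⊢
  rw [← h]
  module

/-! ### Smoothness -/

variable [IsManifold 𝓘(ℂ) ω M] {α β : Form M (EndE n)}

theorem SmoothForm.add (hα : SmoothForm α) (hβ : SmoothForm β) :
    SmoothForm (fun x => α x + β x) :=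
  fun U hU X hX => SmoothOn.add (hα U hU X hX) (hβ U hU X hX)

theorem SmoothForm.smul (hα : SmoothForm α) (c : ℂ) : SmoothForm (fun x => c • α x) :=
  fun U hU X hX => SmoothOn.const_smul (hα U hU X hX) c

theorem SmoothForm.part10 (hα : SmoothForm α) : SmoothForm (part10 α) := fun U hU X hX =>
  (((hα U hU X hX).add ((hα U hU _ hX.J).const_smul (-Complex.I))).const_smul (1 / 2)).congr
    fun x _ => by rw [part10_apply, neg_smul, sub_eq_add_neg]

theorem SmoothForm.part01 (hα : SmoothForm α) : SmoothForm (part01 α) := fun U hU X hX =>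
  ((hα U hU X hX).add ((hα U hU _ hX.J).const_smul Complex.I)).const_smul (1 / 2)

theorem SmoothForm.qLam (hq : SmoothForm q) (t : ℂ) : SmoothForm (qLam q t) :=
  (hq.part10.smul _).add (hq.part01.smul _)

theorem SmoothForm.adForm (hq : SmoothForm q) {φ : M → (E n ≃L[ℂ] E n)}
    (hφ : SmoothOn (fun x => (φ x : EndE n)) Set.univ) : SmoothForm (adForm φ q) :=
  fun U hU X hX => ((hφ.mono (Set.subset_univ U)).mul (hq U hU X hX)).mul
    (hφ.symm.mono (Set.subset_univ U))

theorem smoothForm_formN (hP : SmoothOn (projV V) Set.univ) : SmoothForm (formN 0 V) := by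
  intro U hU X hX
  have h1 := (hP.mono (Set.subset_univ U)).diff_apply hU hX
  have h2 := (h1.add (((hP.mono (Set.subset_univ U)).mul h1).const_smul (-2)))
  refine h2.congr fun x _ => ?_
  ext1 w
  rw [formN_apply (hP.mdifferentiableAt isOpen_univ (Set.mem_univ x)), sub_eq_add_neg, ← neg_smul]
  rfl

theorem smoothForm_loopConn (hP : SmoothOn (projV V) Set.univ) (hq : SmoothForm q) (t : ℂ) :
    SmoothForm (loopConn 0 V q t) := by
  have hN := smoothForm_formN hP
  have h := (((hN.part10.smul (t⁻¹ - 1)).add (hN.part01.smul (t - 1))).add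
    (hq.part10.smul ((t ^ 2)⁻¹ - 1))).add (hq.part01.smul (t ^ 2 - 1))
  intro U hU X hX
  refine (h U hU X hX).congr fun x _ => ?_
  ext1 w
  exact loopConn_apply t x (X x) w

theorem SmoothForm.cov (hα : SmoothForm α) {U : Set M} (hU : IsOpen U) {s : M → E n}
    (hs : SmoothOn s U) {X : (x : M) → T x} (hX : SmoothFieldOn X U) :
    SmoothOn (fun x => cov α s x (X x)) U :=
  (hs.diff_apply hU hX).add ((hα U hU X hX).eval hs)

end LoopConnections

/-! ### Transport by a parallel isometry -/

section Deformation

variable {M : Type*} [TopologicalSpace M] [ChartedSpace ℂ M] {n : ℕ}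

/-! ### Parallel isometries -/

section Parallel

variable {a : Form M (EndE n)} {φ : M → (E n ≃L[ℂ] E n)}

/-- Testing parallelism on constant sections gives dφ = φ a; by the product rule this equation
conversely gives parallelism (`isParallelIsometry_of_diff`). -/
theorem IsParallelIsometry.diff_apply (h : IsParallelIsometry a 0 φ) (x : M) (v : T x) (w : E n) :
    diff (fun y => (φ y : EndE n)) x v w = φ x (a x v w) := by
  have h1 := h.2.2 Set.univ isOpen_univ (fun _ => w) (SmoothOn.const w _) x (Set.mem_univ x) v
  rw [cov_apply, cov_apply, diff_const] at h1
  have h2 := diff_clm_apply_const (h.1.mdifferentiableAt isOpen_univ (Set.mem_univ x)) v w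
  refine h2.symm.trans ((add_zero _).symm.trans (h1.trans ?_))
  exact congrArg (φ x) (zero_add _)

theorem isParallelIsometry_of_diff (hφ : SmoothOn (fun x => (φ x : EndE n)) Set.univ)
    (hi : ∀ x u w, bil n (φ x u) (φ x w) = bil n u w)
    (hd : ∀ x v w, diff (fun y => (φ y : EndE n)) x v w = φ x (a x v w)) :
    IsParallelIsometry a 0 φ := by
  refine ⟨hφ, hi, fun U hU s hs x hx v => ?_⟩
  have h := diff_clm_apply (hφ.mdifferentiableAt isOpen_univ (Set.mem_univ x))
    (hs.mdifferentiableAt hU hx) v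
  rw [cov_apply, cov_apply]
  refine (add_zero _).trans (h.trans ?_)
  rw [hd, map_add, add_comm]
  rfl

omit [TopologicalSpace M] [ChartedSpace ℂ M] in
theorem mem_mapBundle {V : M → Submodule ℂ (E n)} {x : M} {w : E n} (hw : w ∈ V x) :
    φ x w ∈ mapBundle φ V x := ⟨w, hw, rfl⟩

omit [TopologicalSpace M] [ChartedSpace ℂ M] in
theorem mem_mapBundle_iff {V : M → Submodule ℂ (E n)} {x : M} {w : E n} :
    w ∈ mapBundle φ V x ↔ (φ x).symm w ∈ V x := by
  constructor
  · rintro ⟨u, hu, rfl⟩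
    change (φ x).symm (φ x u) ∈ V x
    rwa [(φ x).symm_apply_apply]
  · exact fun h => ⟨_, h, (φ x).apply_symm_apply w⟩

omit [TopologicalSpace M] [ChartedSpace ℂ M] in
theorem mapBundle_inf (L L' : M → Submodule ℂ (E n)) :
    (fun x => mapBundle φ L x ⊓ mapBundle φ L' x) = mapBundle φ (fun x => L x ⊓ L' x) := by
  funext x
  ext w
  rw [Submodule.mem_inf, mem_mapBundle_iff, mem_mapBundle_iff, mem_mapBundle_iff,
    Submodule.mem_inf]

theorem IsSection.symm {V : M → Submodule ℂ (E n)} {U : Set M} {s : M → E n}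
    (hφ : SmoothOn (fun x => (φ x : EndE n)) Set.univ) (hs : IsSection (mapBundle φ V) U s) :
    IsSection V U (fun x => (φ x).symm (s x)) :=
  ⟨hs.1, (hφ.symm.mono (Set.subset_univ U)).eval hs.2.1, fun y hy =>
    mem_mapBundle_iff.1 (hs.2.2 y hy)⟩

end Parallel

variable {V L10 L01 : M → Submodule ℂ (E n)} {q : Form M (EndE n)} {t : ℂ}
  {φ : M → (E n ≃L[ℂ] E n)}

/-- The derivative of π_{φV} φ = φ π is dπ_{φV} φ = φ (dπ + [a, π]). The q-terms of a commute with
π, and (1-2π)[N, π] = N for the off-diagonal N, so each type of N gains λ^{∓1} - 1. -/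
theorem formN_mapBundle (hP : SmoothOn (projV V) Set.univ) (hnd : ∀ x, IsNondeg (V x))
    (hP' : SmoothOn (projV (mapBundle φ V)) Set.univ)
    (hq : ∀ x v, q x v ∈ wedgeSq (V x) ⊔ wedgeSq (perp (V x)))
    (hφ : IsParallelIsometry (loopConn 0 V q t) 0 φ) (x : M) (v : T x) (u : E n) :
    formN 0 (mapBundle φ V) x v (φ x u)
      = φ x (t⁻¹ • part10 (formN 0 V) x v u + t • part01 (formN 0 V) x v u) := by
  have hPx := hP.mdifferentiableAt isOpen_univ (Set.mem_univ x)
  have hPx' := hP'.mdifferentiableAt isOpen_univ (Set.mem_univ x)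
  have hφx := hφ.1.mdifferentiableAt isOpen_univ (Set.mem_univ x)
  have hproj : ∀ y w, projV (mapBundle φ V) y (φ y w) = φ y (projV V y w) := fun y w =>
    orthProj_map (hφ.2.1 y) (hnd y) w
  have hev {A : M → EndE n} (hA : SmoothOn A Set.univ) :
      MDifferentiableAt 𝓘(ℝ, ℂ) 𝓘(ℝ, E n) (fun y => A y u) x :=
    (hA.eval (SmoothOn.const u _)).mdifferentiableAt isOpen_univ (Set.mem_univ x)
  set a := loopConn 0 V q t with ha
  -- Both sides of π_{φV} φ u = φ π u are differentiated with u constant.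
  have hd : diff (projV (mapBundle φ V)) x v (φ x u) =
      φ x (a x v (projV V x u) + diff (projV V) x v u - projV V x (a x v u)) := by
    have h1 := diff_clm_apply hPx' (hev hφ.1) v
    have h2 := diff_clm_apply hφx (hev hP) v
    have e : (fun y => projV (mapBundle φ V) y ((φ y : EndE n) u))
        = fun y => (φ y : EndE n) (projV V y u) := funext fun y => hproj y u
    rw [e, h2, hφ.diff_apply, diff_clm_apply_const hφx, diff_clm_apply_const hPx,
      hφ.diff_apply] at h1
    rw [map_sub, map_add, ← hproj x (a x v u)]
    exact eq_sub_of_add_eq h1.symm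
  have hqc : ∀ v, q x v (projV V x u) = projV V x (q x v u) := fun v =>
    (congrArg (fun A : EndE n => A u) (commute_orthProj (hnd x) (hq x v))).symm
  have hq10 : part10 q x v (projV V x u) = projV V x (part10 q x v u) := by
    rw [part10_apply_apply, part10_apply_apply, hqc, hqc, map_smul, map_sub, map_smul]
  have hq01 : part01 q x v (projV V x u) = projV V x (part01 q x v u) := by
    rw [part01_apply_apply, part01_apply_apply, hqc, hqc, map_smul, map_add, map_smul]
  have hN := formN_apply hPx v u
  have h10 := part10_formN_projV hPx v u
  have h01 := part01_formN_projV hPx v u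
  -- π N^{1,0} π = 0: N has no V-to-V component.
  have k10 : projV V x (part10 (formN 0 V) x v (projV V x u)) = 0 := by
    have := congrArg (projV V x) h10
    rwa [map_add, projV_projV, add_eq_right] at this
  have k01 : projV V x (part01 (formN 0 V) x v (projV V x u)) = 0 := by
    have := congrArg (projV V x) h01
    rwa [map_add, projV_projV, add_eq_right] at this
  rw [formN_apply hPx', hd, hproj, ← map_smul, ← map_sub]
  congr 1
  rw [ha, loopConn_apply, loopConn_apply, hq10, hq01]
  simp only [map_add, map_sub, map_smul, projV_projV, k10, k01]
  have hs := part10_add_part01_apply (formN 0 V) x v u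
  linear_combination (norm := module) (t⁻¹ - 1) • h10 + (t - 1) • h01 - hN - hs

theorem part10_formN_mapBundle (h : ∀ x v u, formN 0 (mapBundle φ V) x v (φ x u)
      = φ x (t⁻¹ • part10 (formN 0 V) x v u + t • part01 (formN 0 V) x v u))
    (x : M) (v : T x) (u : E n) :
    part10 (formN 0 (mapBundle φ V)) x v (φ x u) = φ x (t⁻¹ • part10 (formN 0 V) x v u) := by
  refine part10_apply_eq (A := fun v => φ x (t⁻¹ • part10 (formN 0 V) x v u))
    (B := fun v => φ x (t • part01 (formN 0 V) x v u)) (fun v => ?_) (fun v => ?_) (fun v => ?_)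
  · rw [h, map_add]
  · rw [part10_J_apply, smul_comm, map_smul]
  · rw [part01_J_apply, smul_neg, smul_comm, map_neg, map_smul]

theorem part01_formN_mapBundle (h : ∀ x v u, formN 0 (mapBundle φ V) x v (φ x u)
      = φ x (t⁻¹ • part10 (formN 0 V) x v u + t • part01 (formN 0 V) x v u))
    (x : M) (v : T x) (u : E n) :
    part01 (formN 0 (mapBundle φ V)) x v (φ x u) = φ x (t • part01 (formN 0 V) x v u) := by
  have h1 := part10_add_part01_apply (formN 0 (mapBundle φ V)) x v (φ x u)
  rw [part10_formN_mapBundle h, h, map_add] at h1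
  exact add_left_cancel h1

/-- The isometry `φ` intertwines the loops of connections of `V` and of `φ V`. -/
theorem loopConn_mapBundle (h : ∀ x v u, formN 0 (mapBundle φ V) x v (φ x u)
      = φ x (t⁻¹ • part10 (formN 0 V) x v u + t • part01 (formN 0 V) x v u))
    (μ : ℂ) (x : M) (v : T x) (u : E n) :
    φ x (loopConn 0 V q t x v u)
      + loopConn 0 (mapBundle φ V) (adForm φ (qLam q t)) μ x v (φ x u)
      = φ x (loopConn 0 V q (t * μ) x v u) := by
  rw [loopConn_apply μ, part10_formN_mapBundle h, part01_formN_mapBundle h,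
    part10_adForm_qLam_map, part01_adForm_qLam_map, loopConn_apply, loopConn_apply]
  -- The coefficients telescope: (t⁻¹ - 1) + t⁻¹(μ⁻¹ - 1) = (tμ)⁻¹ - 1, and likewise for t, t⁻² and
  -- t².
  rw [mul_inv, mul_pow, mul_inv]
  simp only [map_smul, map_add]
  module

section Flat

variable [IsManifold 𝓘(ℂ) ω M] {a b c : Form M (EndE n)}

/-- Flatness is carried along by fields of isomorphisms that intertwine the connections. -/
theorem IsFlat.of_intertwining (hb : IsFlat b) (hbs : SmoothForm b)
    (hφ : SmoothOn (fun x => (φ x : EndE n)) Set.univ)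
    (hd : ∀ x v w, diff (fun y => (φ y : EndE n)) x v w = φ x (a x v w))
    (h : ∀ x v u, φ x (a x v u) + c x v (φ x u) = φ x (b x v u)) : IsFlat c := by
  -- The gauge relation (d + c) φ = φ (d + b). Here r is only required to agree with φ s on U, so
  -- that the relation can be iterated for second derivatives.
  have key : ∀ U : Set M, IsOpen U → ∀ s r : M → E n, SmoothOn s U → (∀ y ∈ U, r y = φ y (s y)) →
      ∀ x ∈ U, ∀ v : T x, cov c r x v = φ x (cov b s x v) := by
    intro U hU s r hs hr x hx v
    have h1 := diff_clm_apply (hφ.mdifferentiableAt isOpen_univ (Set.mem_univ x))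
      (hs.mdifferentiableAt hU hx) v
    rw [cov_apply, cov_apply, diff_congr hU hr hx, hr x hx, map_add, ← h, ← hd]
    refine (congrArg (· + _) h1).trans ?_
    change _ + φ x (diff s x v) + _ = _
    abel
  intro U hU X Y hX hY s hs x hx
  have hr : SmoothOn (fun y => (φ y).symm (s y)) U := (hφ.symm.mono (Set.subset_univ U)).eval hs
  have e : ∀ y ∈ U, s y = φ y ((φ y).symm (s y)) := fun y _ => ((φ y).apply_symm_apply _).symm
  rw [key U hU _ _ (hbs.cov hU hr hY) (fun y hy => key U hU _ _ hr e y hy _) x hx,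
    key U hU _ _ (hbs.cov hU hr hX) (fun y hy => key U hU _ _ hr e y hy _) x hx,
    key U hU _ _ hr e x hx, ← map_sub, ← map_sub, hb U hU X Y hX hY _ hr x hx, map_zero]

end Flat

theorem part10_clm_apply {s : M → E n} {r : M → E n} {a : Form M (EndE n)} {x : M}
    (L : EndE n) (h : ∀ v : T x, cov 0 r x v = L (cov a s x v)) (v : T x) :
    part10 (cov 0 r) x v = L (part10 (cov a s) x v) := by
  rw [part10_apply, part10_apply, h, h, map_smul, map_sub, map_smul]

theorem part01_clm_apply {s : M → E n} {r : M → E n} {a : Form M (EndE n)} {x : M}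
    (L : EndE n) (h : ∀ v : T x, cov 0 r x v = L (cov a s x v)) (v : T x) :
    part01 (cov 0 r) x v = L (part01 (cov a s) x v) := by
  rw [part01_apply, part01_apply, h, h, map_smul, map_add, map_smul]

theorem IsSection.cov_eq {a : Form M (EndE n)} {U : Set M} {r : M → E n}
    (hφ : IsParallelIsometry a 0 φ) (hr : IsSection (mapBundle φ V) U r) {x : M}
    (hx : x ∈ U) (v : T x) :
    cov 0 r x v = φ x (cov a (fun y => (φ y).symm (r y)) x v) := by
  rw [← hφ.2.2 U hr.1 _ (hr.symm hφ.1).2.1 x hx v]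
  simp only [ContinuousLinearEquiv.apply_symm_apply]

/-- On `Λ^{0,1}` the `(1,0)`-part of `∇_V^{t,q}` is that of the trivial connection. -/
theorem part10_loopConn_eq_zero (hN : ∀ x, ∀ v : T x, ∀ w ∈ L01 x, part10 (formN 0 V) x v w = 0)
    (hi : ∀ x, IsIsotropic (L01 x)) (hq : ∀ x v, part10 q x v ∈ wedgeSq (L01 x))
    {x : M} {w : E n} (hw : w ∈ L01 x) (v : T x) : part10 (loopConn 0 V q t) x v w = 0 := by
  rw [part10_loopConn_apply, hN x v w hw,
    wedgeSq_apply_eq_zero (hq x v) fun u hu => hi x u hu w hw, smul_zero, smul_zero, add_zero]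

/-- On `Λ^{1,0}` the `(0,1)`-part of `∇_V^{t,q}` is that of the trivial connection. -/
theorem part01_loopConn_eq_zero (hN : ∀ x, ∀ v : T x, ∀ w ∈ L10 x, part01 (formN 0 V) x v w = 0)
    (hi : ∀ x, IsIsotropic (L10 x)) (hq : ∀ x v, part01 q x v ∈ wedgeSq (L10 x))
    {x : M} {w : E n} (hw : w ∈ L10 x) (v : T x) : part01 (loopConn 0 V q t) x v w = 0 := by
  rw [part01_loopConn_apply, hN x v w hw,
    wedgeSq_apply_eq_zero (hq x v) fun u hu => hi x u hu w hw, smul_zero, smul_zero, add_zero]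

variable [IsManifold 𝓘(ℂ) ω M]

/-- All of part 1: each algebraic condition is equivariant under isometries up to scaling of types,
and each differential one reduces to `formN_mapBundle`, `loopConn_mapBundle` or the vanishing of a
on Λ. -/
theorem IsConstrainedWillmoreVia.mapBundle (h : IsConstrainedWillmoreVia 0 q V L10 L01)
    (ht : t ≠ 0) (hφ : IsParallelIsometry (loopConn 0 V q t) 0 φ) :
    IsConstrainedWillmoreVia 0 (adForm φ (qLam q t)) (mapBundle φ V) (mapBundle φ L10)
      (mapBundle φ L01) := by
  obtain ⟨⟨hb10, hb01, hi10, hi01, hb, hsec⟩, ⟨hV4, hnd, hle, hN10, hN01⟩,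
    ⟨-, -, hqs, hqV, hflat⟩, hq10, hq01⟩ := h
  have hV4' := hV4.map hφ.1
  have hnd' : ∀ x, IsNondeg (Willmore.mapBundle φ V x) := fun x =>
    isNondeg_map (hφ.2.1 x) (hnd x)
  have hP := smoothOn_projV hV4 hnd
  have hN := formN_mapBundle hP hnd (smoothOn_projV hV4' hnd') hqV hφ
  have hq10' : ∀ x v, part10 (adForm φ (qLam q t)) x v
      ∈ wedgeSq (Willmore.mapBundle φ L01 x) := by
    intro x v
    have e : part10 (adForm φ (qLam q t)) x v
        = (t ^ 2)⁻¹ • ((φ x : EndE n) * part10 q x v * ((φ x).symm : EndE n)) := by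
      ext1 w
      obtain ⟨u, rfl⟩ := (φ x).surjective w
      rw [part10_adForm_qLam_map, map_smul]
      change _ = (t ^ 2)⁻¹ • φ x (part10 q x v ((φ x).symm (φ x u)))
      rw [(φ x).symm_apply_apply]
    rw [e]
    exact Submodule.smul_mem _ _ (wedgeSq_map (hφ.2.1 x) (hq10 x v))
  have hq01' : ∀ x v, part01 (adForm φ (qLam q t)) x v
      ∈ wedgeSq (Willmore.mapBundle φ L10 x) := by
    intro x v
    have e : part01 (adForm φ (qLam q t)) x v
        = (t ^ 2) • ((φ x : EndE n) * part01 q x v * ((φ x).symm : EndE n)) := by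
      ext1 w
      obtain ⟨u, rfl⟩ := (φ x).surjective w
      rw [part01_adForm_qLam_map, map_smul]
      change _ = (t ^ 2) • φ x (part01 q x v ((φ x).symm (φ x u)))
      rw [(φ x).symm_apply_apply]
    rw [e]
    exact Submodule.smul_mem _ _ (wedgeSq_map (hφ.2.1 x) (hq01 x v))
  refine ⟨⟨hb10.map hφ.1, hb01.map hφ.1, fun x => isIsotropic_map (hφ.2.1 x) (hi10 x),
    fun x => isIsotropic_map (hφ.2.1 x) (hi01 x), ?_, ?_⟩, ⟨hV4', hnd', ?_, ?_, ?_⟩,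
    ⟨⟨4, hV4'⟩, hnd', (hqs.qLam t).adForm hφ.1, ?_, ?_⟩, hq10', hq01'⟩
  · rw [mapBundle_inf]
    exact hb.map hφ.1
  · rw [mapBundle_inf]
    intro U r hr x hx v
    have hs := hr.symm hφ.1
    have hc := hr.cov_eq hφ hx
    obtain ⟨h1, h2⟩ := hsec U _ hs x hx v
    rw [cov_zero] at h1 h2
    obtain ⟨m1, m2⟩ := hs.2.2 x hx
    -- The section φ⁻¹ r lies in both Λ^{0,1} and Λ^{1,0}, so each type part of a annihilates it and
    -- only d remains.
    rw [part10_clm_apply (φ x : EndE n) hc, part01_clm_apply (φ x : EndE n) hc, part10_cov, part01_cov,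
      part10_loopConn_eq_zero hN10 hi01 hq10 m2, part01_loopConn_eq_zero hN01 hi10 hq01 m1]
    rw [add_zero, add_zero]
    exact ⟨mem_mapBundle h1, mem_mapBundle h2⟩
  · intro x
    refine sup_le (Submodule.map_mono (le_sup_left.trans (hle x)))
      (Submodule.map_mono (le_sup_right.trans (hle x)))
  · rintro x v _ ⟨w, hw, rfl⟩
    refine (part10_formN_mapBundle hN x v w).trans ?_
    rw [hN10 x v w hw, smul_zero, map_zero]
  · rintro x v _ ⟨w, hw, rfl⟩
    refine (part01_formN_mapBundle hN x v w).trans ?_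
    rw [hN01 x v w hw, smul_zero, map_zero]
  · intro x v
    -- Both type parts already lie in ∧²φV, so no component in the complement is needed.
    rw [← part10_add_part01 (adForm φ (qLam q t)) x v]
    exact Submodule.mem_sup_left (Submodule.add_mem _
      (wedgeSq_mono (Submodule.map_mono (le_sup_right.trans (hle x))) (hq10' x v))
      (wedgeSq_mono (Submodule.map_mono (le_sup_left.trans (hle x))) (hq01' x v)))
  · intro μ hμ
    -- Flatness at μ for φV is flatness at tμ for V.
    exact (hflat (t * μ) (mul_ne_zero ht hμ)).of_intertwining (smoothForm_loopConn hP hqs _) hφ.1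
      hφ.diff_apply (loopConn_mapBundle hN μ)

end Deformation

/-! ### Real structures -/

section Reality

variable {n : ℕ}

/-! ### Complex conjugation -/

theorem conjE_apply (w : E n) (i : Fin (n + 2)) : conjE w i = (starRingEnd ℂ) (w i) := rfl

theorem conjE_conjE (w : E n) : conjE (conjE w) = w := by
  funext i
  simp [conjE_apply]

theorem conjE_add (u w : E n) : conjE (u + w) = conjE u + conjE w := by
  funext i
  simp [conjE_apply]

theorem conjE_smul (c : ℂ) (w : E n) : conjE (c • w) = (starRingEnd ℂ) c • conjE w := by
  funext i
  simp [conjE_apply]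

/-- Complex conjugation, as a real linear map. -/
noncomputable def conjL (n : ℕ) : E n →L[ℝ] E n :=
  LinearMap.toContinuousLinearMap
    { toFun := conjE
      map_add' := conjE_add
      map_smul' := fun c w => by
        funext i
        simp [conjE_apply] }

theorem conjE_sub (u w : E n) : conjE (u - w) = conjE u - conjE w := (conjL n).map_sub u w

theorem conjE_eq_zero {w : E n} : conjE w = 0 ↔ w = 0 := by
  constructor
  · intro h
    rw [← conjE_conjE w, h]
    exact (conjL n).map_zero
  · rintro rfl
    exact (conjL n).map_zero

theorem bil_conjE (u w : E n) : bil n (conjE u) (conjE w) = (starRingEnd ℂ) (bil n u w) := by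
  simp [bil_apply, conjE_apply]

/-- The metric has real coefficients, so conjugation preserves W^⊥ together with W. -/
theorem orthProj_conjE {W : Submodule ℂ (E n)} (hnd : IsNondeg W) (hW : ∀ w ∈ W, conjE w ∈ W) :
    IsRealEnd (orthProj W) := by
  intro w
  refine orthProj_eq hnd (hW _ (orthProj_mem W w)) ?_
  rw [← conjE_sub]
  intro u hu
  change bil n u _ = 0
  rw [← conjE_conjE u, bil_conjE, sub_orthProj_mem hnd w _ (hW u hu), map_zero]

/-- A subspace of dimension four is spanned by three vectors orthogonal to one of them and a fourth
one that is not orthogonal to that one. -/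
theorem eq_span_of_orthogonal {W : Submodule ℂ (E n)} (hW : Module.finrank ℂ W = 4)
    {a b c u : E n} (ha : a ∈ W) (hb : b ∈ W) (hc : c ∈ W) (hu : u ∈ W)
    (hli : LinearIndependent ℂ ![a, b, c]) (haa : bil n a a = 0) (hab : bil n a b = 0)
    (hac : bil n a c = 0) (hau : bil n a u ≠ 0) :
    W = Submodule.span ℂ {u, a, b, c} := by
  have hnot : u ∉ Submodule.span ℂ (Set.range ![a, b, c]) := by
    intro h
    have hle : Submodule.span ℂ (Set.range ![a, b, c]) ≤ LinearMap.ker (bil n a) := by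
      rw [Submodule.span_le]
      rintro _ ⟨i, rfl⟩
      fin_cases i
      · exact haa
      · exact hab
      · exact hac
    exact hau (hle h)
  have hli4 : LinearIndependent ℂ ![u, a, b, c] := linearIndependent_finCons.2 ⟨hli, hnot⟩
  have hr : Set.range ![u, a, b, c] = {u, a, b, c} := by
    simp only [Matrix.range_cons, Matrix.range_empty, Set.union_empty, Set.singleton_union]
  rw [← hr]
  refine (Submodule.eq_of_le_of_finrank_eq ?_ ?_).symm
  · rw [hr, Submodule.span_le]
    rintro _ (rfl | rfl | rfl | rfl) <;> assumption
  · rw [finrank_span_eq_card hli4, hW, Fintype.card_fin]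

variable {M : Type*} [TopologicalSpace M] [ChartedSpace ℂ M]

theorem IsSubbundle.finrank_eq {r : ℕ} {V : M → Submodule ℂ (E n)} (hV : IsSubbundle r V) (x : M) :
    Module.finrank ℂ (V x) = r := by
  obtain ⟨U, hU, hx, s, hs, hsp⟩ := hV x
  obtain ⟨hli, hspan⟩ := hsp x hx
  rw [hspan, finrank_span_eq_card hli, Fintype.card_fin]

theorem SmoothOn.conjE {s : M → E n} {U : Set M} (hs : SmoothOn s U) :
    SmoothOn (fun y => conjE (s y)) U := hs.clm_comp (conjL n)

theorem diff_conjE {s : M → E n} {x : M} (hs : MDifferentiableAt 𝓘(ℝ, ℂ) 𝓘(ℝ, E n) s x)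
    (v : T x) : diff (fun y => conjE (s y)) x v = conjE (diff s x v) :=
  diff_clm_comp hs (conjL n) v

/-- Conjugation is antilinear over i and therefore exchanges types. -/
theorem part01_diff_conjE {s : M → E n} {x : M} (hs : MDifferentiableAt 𝓘(ℝ, ℂ) 𝓘(ℝ, E n) s x)
    (v : T x) : part01 (diff fun y => conjE (s y)) x v = conjE (part10 (diff s) x v) := by
  rw [part01_apply, part10_apply, diff_conjE hs, diff_conjE hs, conjE_smul, conjE_sub, conjE_smul,
    Complex.conj_I, neg_smul, sub_neg_eq_add, map_div₀, map_one, map_ofNat]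

theorem conjE_part10 {α : Form M (EndE n)} (hα : IsRealForm α) (x : M) (v : T x) (w : E n) :
    conjE (part10 α x v w) = part01 α x v (conjE w) := by
  rw [part01_apply_apply, part10_apply_apply, hα, hα, conjE_smul, conjE_sub, conjE_smul,
    Complex.conj_I, neg_smul, sub_neg_eq_add, map_div₀, map_one, map_ofNat]

theorem conjE_part01 {α : Form M (EndE n)} (hα : IsRealForm α) (x : M) (v : T x) (w : E n) :
    conjE (part01 α x v w) = part10 α x v (conjE w) := by
  rw [← conjE_conjE w, ← conjE_part10 hα, conjE_conjE, conjE_conjE]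

theorem isRealForm_formN {V : M → Submodule ℂ (E n)} (hP : SmoothOn (projV V) Set.univ)
    (hnd : ∀ x, IsNondeg (V x)) (hV : IsRealBundle V) : IsRealForm (formN 0 V) := by
  have hPr : ∀ x, IsRealEnd (projV V x) := fun x => orthProj_conjE (hnd x) (hV x)
  intro x v w
  have hPx := hP.mdifferentiableAt isOpen_univ (Set.mem_univ x)
  have hd : diff (projV V) x v (conjE w) = conjE (diff (projV V) x v w) := by
    rw [← diff_clm_apply_const hPx, ← diff_clm_apply_const hPx, ← diff_conjE]
    · congr 2
      funext y
      exact hPr y w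
    · exact (hP.eval (SmoothOn.const w _)).mdifferentiableAt isOpen_univ (Set.mem_univ x)
  rw [formN_apply hPx, formN_apply hPx, hd, hPr x, conjE_sub, conjE_smul, map_ofNat]

/-- Conjugation exchanges the (1,0) and (0,1) parts of N and q, and on the unit circle exchanges t
with t⁻¹; the terms are permuted in pairs. -/
theorem isRealForm_loopConn {V : M → Submodule ℂ (E n)} {q : Form M (EndE n)}
    (hN : IsRealForm (formN 0 V)) (hq : IsRealForm q) {t : ℂ} (ht : (starRingEnd ℂ) t = t⁻¹) :
    IsRealForm (loopConn 0 V q t) := by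
  intro x v w
  rw [loopConn_apply, loopConn_apply]
  simp only [conjE_add, conjE_smul, conjE_part10 hN, conjE_part01 hN, conjE_part10 hq,
    conjE_part01 hq, map_sub, map_one, map_inv₀, map_pow, ht, inv_inv, inv_pow]
  abel

theorem isRealForm_qLam {q : Form M (EndE n)} (hq : IsRealForm q) {t : ℂ}
    (ht : (starRingEnd ℂ) t = t⁻¹) : IsRealForm (qLam q t) := by
  intro x v w
  rw [qLam_apply, qLam_apply]
  simp only [conjE_add, conjE_smul, conjE_part10 hq, conjE_part01 hq, map_inv₀, map_pow, ht,
    inv_inv, inv_pow]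
  abel

theorem isRealForm_adForm {q : Form M (EndE n)} (hq : IsRealForm q) {φ : M → (E n ≃L[ℂ] E n)}
    (hφ : IsRealIso φ) : IsRealForm (adForm φ q) := by
  intro x v w
  obtain ⟨u, rfl⟩ := (φ x).surjective w
  have h : ∀ u, conjE (φ x u) = φ x (conjE u) := fun u => (hφ x u).symm
  rw [h, adForm_apply_map, adForm_apply_map, hq, h]

/-! ### The central sphere congruence of a real surface is real -/

section CentralSphere

variable [IsManifold 𝓘(ℂ) ω M]

theorem SmoothOn.part10_diff {s : M → E n} {U : Set M} (hs : SmoothOn s U) (hU : IsOpen U)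
    {X : (x : M) → T x} (hX : SmoothFieldOn X U) :
    SmoothOn (fun y => part10 (diff s) y (X y)) U :=
  (((hs.diff_apply hU hX).add ((hs.diff_apply hU hX.J).const_smul (-Complex.I))).const_smul
    (1 / 2)).congr fun x _ => by rw [part10_apply, neg_smul, sub_eq_add_neg]

theorem SmoothOn.part01_diff {s : M → E n} {U : Set M} (hs : SmoothOn s U) (hU : IsOpen U)
    {X : (x : M) → T x} (hX : SmoothFieldOn X U) :
    SmoothOn (fun y => part01 (diff s) y (X y)) U :=
  ((hs.diff_apply hU hX).add ((hs.diff_apply hU hX.J).const_smul Complex.I)).const_smul (1 / 2)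

end CentralSphere

/-- The difference d - N is D_V, which preserves sections of V. So a type of derivative on which N
vanishes stays in V. -/
theorem diff_sub_formN_mem {V : M → Submodule ℂ (E n)} (hP : SmoothOn (projV V) Set.univ)
    (hnd : ∀ x, IsNondeg (V x)) {U : Set M} {s : M → E n} (hs : IsSection V U s) {x : M}
    (hx : x ∈ U) (v : T x) : diff s x v - formN 0 V x v (s x) ∈ V x := by
  have hPx := hP.mdifferentiableAt isOpen_univ (Set.mem_univ x)
  have h := diff_clm_apply hPx (hs.2.1.mdifferentiableAt hs.1 hx) v
  have e : ∀ y ∈ U, projV V y (s y) = s y := fun y hy => orthProj_of_mem (hnd y) (hs.2.2 y hy)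
  rw [diff_congr hs.1 e hx] at h
  rw [formN_apply hPx]
  have : diff s x v - (diff (projV V) x v (s x) - (2 : ℂ) • projV V x (diff (projV V) x v (s x)))
      = projV V x (diff s x v) + (2 : ℂ) • projV V x (diff (projV V) x v (s x)) := by
    rw [← sub_eq_zero] at h ⊢
    rw [← h]
    abel
  rw [this]
  exact (V x).add_mem (orthProj_mem _ _) ((V x).smul_mem _ (orthProj_mem _ _))

theorem part10_diff_mem {V : M → Submodule ℂ (E n)} (hP : SmoothOn (projV V) Set.univ)
    (hnd : ∀ x, IsNondeg (V x)) {U : Set M} {s : M → E n} (hs : IsSection V U s) {x : M}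
    (hx : x ∈ U) (v : T x) (h0 : part10 (formN 0 V) x v (s x) = 0) :
    part10 (diff s) x v ∈ V x := by
  have h1 := diff_sub_formN_mem hP hnd hs hx
  have : part10 (diff s) x v = (1 / 2 : ℂ) • ((diff s x v - formN 0 V x v (s x))
      - Complex.I • (diff s x (J x v) - formN 0 V x (J x v) (s x))) := by
    rw [← sub_zero (part10 (diff s) x v), ← h0, part10_apply, part10_apply_apply]
    module
  rw [this]
  exact (V x).smul_mem _ ((V x).sub_mem (h1 v) ((V x).smul_mem _ (h1 _)))

theorem part01_diff_mem {V : M → Submodule ℂ (E n)} (hP : SmoothOn (projV V) Set.univ)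
    (hnd : ∀ x, IsNondeg (V x)) {U : Set M} {s : M → E n} (hs : IsSection V U s) {x : M}
    (hx : x ∈ U) (v : T x) (h0 : part01 (formN 0 V) x v (s x) = 0) :
    part01 (diff s) x v ∈ V x := by
  have h1 := diff_sub_formN_mem hP hnd hs hx
  have : part01 (diff s) x v = (1 / 2 : ℂ) • ((diff s x v - formN 0 V x v (s x))
      + Complex.I • (diff s x (J x v) - formN 0 V x (J x v) (s x))) := by
    rw [← sub_zero (part01 (diff s) x v), ← h0, part01_apply, part01_apply_apply]
    module
  rw [this]
  exact (V x).smul_mem _ ((V x).add_mem (h1 v) ((V x).smul_mem _ (h1 _)))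

/-- A real line bundle has real nowhere zero local sections. -/
theorem exists_real_section {Λ : M → Submodule ℂ (E n)} (hΛ : IsSubbundle 1 Λ)
    (hr : IsRealBundle Λ) (x : M) : ∃ U s, x ∈ U ∧ IsSection Λ U s ∧
      ∀ y ∈ U, s y ≠ 0 ∧ conjE (s y) = s y := by
  obtain ⟨U, hU, hx, s, hs, hsp⟩ := hΛ x
  have hmem : ∀ y ∈ U, s 0 y ∈ Λ y := fun y hy => by
    rw [(hsp y hy).2]
    exact Submodule.subset_span ⟨0, rfl⟩
  -- The real parts for c = 1 and c = i cannot both vanish, since s + s̄ = 0 and s - s̄ = 0 would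
  -- force s = 0.
  have key : ∃ c : ℂ, c • s 0 x + conjE (c • s 0 x) ≠ 0 := by
    by_contra! hcon
    have h1 := hcon 1
    have h2 := hcon Complex.I
    rw [one_smul] at h1
    rw [conjE_smul, Complex.conj_I, neg_smul, ← sub_eq_add_neg, ← smul_sub] at h2
    have h3 := (smul_eq_zero.1 h2).resolve_left Complex.I_ne_zero
    have h4 : (2 : ℂ) • s 0 x = 0 := by
      linear_combination (norm := module) h1 + h3
    exact (hsp x hx).1.ne_zero 0 ((smul_eq_zero.1 h4).resolve_left two_ne_zero)
  obtain ⟨c, hc⟩ := key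
  have hσ : SmoothOn (fun y => c • s 0 y + conjE (c • s 0 y)) U :=
    ((hs 0).const_smul c).add ((hs 0).const_smul c).conjE
  refine ⟨U ∩ (fun y => c • s 0 y + conjE (c • s 0 y)) ⁻¹' {0}ᶜ, _, ⟨hx, hc⟩,
    ⟨hσ.continuousOn.isOpen_inter_preimage hU isOpen_compl_singleton,
      hσ.mono Set.inter_subset_left, fun y hy => ?_⟩, fun y hy => ⟨hy.2, ?_⟩⟩
  · have := (Λ y).smul_mem c (hmem y hy.1)
    exact (Λ y).add_mem this (hr y _ this)
  · rw [conjE_add, conjE_conjE, add_comm]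

/-- The derivative of a section is spanned by its values on one tangent vector and `J` of it. -/
theorem exists_smul_add_smul_J {x : M} {X : T x} (hX : X ≠ 0) (v : T x) :
    ∃ a b : ℝ, v = a • X + b • J x X := by
  have hX' : (show ℂ from X) ≠ 0 := hX
  set c : ℂ := (show ℂ from v) / (show ℂ from X) with hc
  refine ⟨c.re, c.im, ?_⟩
  change (show ℂ from v) = c.re • (show ℂ from X) + c.im • (Complex.I * (show ℂ from X))
  rw [Complex.real_smul, Complex.real_smul, ← mul_assoc, ← add_mul, Complex.re_add_im, hc,
    div_mul_cancel₀ _ hX']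

theorem diff_mem_span_part {s : M → E n} {x : M} {X : T x} (hX : X ≠ 0) (v : T x) :
    diff s x v ∈ Submodule.span ℂ {part10 (diff s) x X, part01 (diff s) x X} := by
  obtain ⟨a, b, rfl⟩ := exists_smul_add_smul_J hX v
  rw [map_add, map_smul, map_smul, ← part10_add_part01 (diff s) x X,
    ← part10_add_part01 (diff s) x (J x X), part10_J, part01_J, Submodule.mem_span_pair]
  -- The vector aX + bJX acts as a + bi on the (1,0) part and as a - bi on the (0,1) part.
  refine ⟨(a : ℂ) + b * Complex.I, (a : ℂ) - b * Complex.I, ?_⟩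
  rw [← Complex.coe_smul, ← Complex.coe_smul]
  module

end Reality

/-! ### Reality of V, of the isometries and of the deformed surface -/

section RealSurfaces

variable {n : ℕ} {M : Type*} [TopologicalSpace M] [ChartedSpace ℂ M] [IsManifold 𝓘(ℂ) ω M]

omit [IsManifold 𝓘(ℂ) ω M] in
theorem bil_part10_diff {s r : M → E n} {U : Set M} (hU : IsOpen U) (hs : SmoothOn s U)
    (hr : SmoothOn r U) (h0 : ∀ y ∈ U, bil n (s y) (r y) = 0) {x : M} (hx : x ∈ U) (v : T x) :
    bil n (part10 (diff s) x v) (r x) + bil n (s x) (part10 (diff r) x v) = 0 := by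
  have h (v : T x) : bil n (diff s x v) (r x) + bil n (s x) (diff r x v) = 0 := by
    rw [← diff_bil (hs.mdifferentiableAt hU hx) (hr.mdifferentiableAt hU hx), diff_congr hU h0 hx,
      diff_const]
    rfl
  simp only [part10_apply, map_smul, map_sub, LinearMap.smul_apply, LinearMap.sub_apply,
    smul_eq_mul]
  linear_combination (1 / 2) * h v - (Complex.I / 2) * h (J x v)

/-- The central sphere congruence of a real surface is real. -/
theorem IsCentralSphereCongruence.isRealBundle {V L10 L01 : M → Submodule ℂ (E n)}
    (hV : IsCentralSphereCongruence 0 V L10 L01) (hL : IsRealSurface L10 L01) :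
    IsRealBundle V := by
  obtain ⟨hV4, hnd, hle, hN10, hN01⟩ := hV
  obtain ⟨⟨hb10, hb01, hi10, hi01, hb, hsec⟩, hΛ, himm⟩ := hL
  have hP := smoothOn_projV hV4 hnd
  intro x
  obtain ⟨U₁, σ, hx₁, hσ₁, hσr⟩ := exists_real_section hb hΛ x
  obtain ⟨U₂, X, hU₂, hx₂, hX, hXx⟩ := exists_smoothFieldOn x
  set U := U₁ ∩ U₂
  have hU : IsOpen U := hσ₁.1.inter hU₂
  have hx : x ∈ U := ⟨hx₁, hx₂⟩
  have hXU : SmoothFieldOn X U := ContMDiffOn.mono hX Set.inter_subset_right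
  have hσ : IsSection (fun x => L10 x ⊓ L01 x) U σ :=
    ⟨hU, hσ₁.2.1.mono Set.inter_subset_left, fun y hy => hσ₁.2.2 y hy.1⟩
  have hσs : ∀ y ∈ U, conjE (σ y) = σ y := fun y hy => (hσr y hy.1).2
  have hmd : ∀ y ∈ U, MDifferentiableAt 𝓘(ℝ, ℂ) 𝓘(ℝ, E n) σ y := fun y hy =>
    hσ.2.1.mdifferentiableAt hU hy
  -- These play the roles of σ_z and σ_z̄; they are conjugate because σ is real.
  set z : M → E n := fun y => part10 (diff σ) y (X y) with hz
  set w : M → E n := fun y => part01 (diff σ) y (X y) with hw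
  have hzs : SmoothOn z U := hσ.2.1.part10_diff hU hXU
  have hws : SmoothOn w U := hσ.2.1.part01_diff hU hXU
  have hzw : ∀ y ∈ U, conjE (z y) = w y := fun y hy => by
    rw [hz, hw]
    dsimp only
    rw [← part01_diff_conjE (hmd y hy), part01_apply, part01_apply, diff_congr hU hσs hy]
  have hwz : ∀ y ∈ U, conjE (w y) = z y := fun y hy => by rw [← hzw y hy, conjE_conjE]
  have hzm : ∀ y ∈ U, z y ∈ L10 y := fun y hy => by
    have := (hsec U σ hσ y hy (X y)).1
    rwa [cov_zero] at this
  have hwm : ∀ y ∈ U, w y ∈ L01 y := fun y hy => by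
    have := (hsec U σ hσ y hy (X y)).2
    rwa [cov_zero] at this
  have hV10 : ∀ y, L10 y ≤ V y := fun y => le_sup_left.trans (hle y)
  have hV01 : ∀ y, L01 y ≤ V y := fun y => le_sup_right.trans (hle y)
  obtain ⟨hσ10, hσ01⟩ := hσ.2.2 x hx
  -- Mixed second derivatives. Both lie in V, as N^{1,0} kills w in Λ^{0,1} and N^{0,1} kills z in
  -- Λ^{1,0}; they are conjugate to each other, and need not be equal.
  set p := part10 (diff w) x (X x) with hp
  set p' := part01 (diff z) x (X x) with hp'
  have hpV : p ∈ V x := part10_diff_mem hP hnd ⟨hU, hws, fun y hy => hV01 y (hwm y hy)⟩ hx _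
    (hN10 x _ _ (hwm x hx))
  have hp'V : p' ∈ V x := part01_diff_mem hP hnd ⟨hU, hzs, fun y hy => hV10 y (hzm y hy)⟩ hx _
    (hN01 x _ _ (hzm x hx))
  have hpp' : conjE p = p' := by
    rw [hp, hp', ← part01_diff_conjE (hws.mdifferentiableAt hU hx), part01_apply, part01_apply,
      diff_congr hU hwz hx]
  -- linear independence of the section and its derivatives
  have hli : LinearIndependent ℂ ![σ x, z x, w x] := by
    rw [linearIndependent_iff_card_le_finrank_span, Fintype.card_fin]
    refine (himm U σ hσ (fun y hy => (hσr y hy.1).1) x hx).ge.trans ?_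
    refine Submodule.finrank_mono (Submodule.span_le.2 ?_)
    have hrange : Set.range ![σ x, z x, w x] = {σ x, z x, w x} := by
      simp only [Matrix.range_cons, Matrix.range_empty, Set.union_empty, Set.singleton_union]
    rw [hrange]
    refine Set.insert_subset (Submodule.subset_span (Set.mem_insert _ _)) ?_
    rintro _ ⟨v, rfl⟩
    refine Submodule.span_mono (Set.subset_insert _ _) ?_
    dsimp only
    rw [cov_zero]
    exact diff_mem_span_part hXx v
  have h4 := hV4.finrank_eq x
  have hσσ := hi10 x _ hσ10 _ hσ10
  have hσz := hi10 x _ hσ10 _ (hzm x hx)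
  have hσw := hi01 x _ hσ01 _ (hwm x hx)
  have hzz := hi10 x _ (hzm x hx) _ (hzm x hx)
  -- the surface is conformally immersed
  have hzw0 : bil n (z x) (w x) ≠ 0 := by
    intro h0
    have hσ0 : σ x ≠ 0 := (hσr x hx₁).1
    obtain ⟨u, hu, hσu⟩ : ∃ u ∈ V x, bil n (σ x) u ≠ 0 := by
      by_contra! hcon
      exact hσ0 ((hnd x).eq_zero (hV10 x hσ10) fun u hu => by rw [bil_comm]; exact hcon u hu)
    have hspan := eq_span_of_orthogonal h4 (hV10 x hσ10) (hV10 x (hzm x hx)) (hV01 x (hwm x hx))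
      hu hli hσσ hσz hσw hσu
    -- If (z, w) = 0, this combination of σ and z is orthogonal to the basis u, σ, z, w of V, hence
    -- zero, contradicting the independence of σ and z.
    have hzero : bil n (z x) u • σ x - bil n (σ x) u • z x = 0 := by
      refine (hnd x).eq_zero ((V x).sub_mem ((V x).smul_mem _ (hV10 x hσ10))
        ((V x).smul_mem _ (hV10 x (hzm x hx)))) fun y hy => ?_
      rw [hspan] at hy
      induction hy using Submodule.span_induction with
      | mem y h =>
        rw [bil_comm, map_sub, map_smul, map_smul, LinearMap.sub_apply, LinearMap.smul_apply,
          LinearMap.smul_apply, smul_eq_mul, smul_eq_mul]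
        rcases h with rfl | rfl | rfl | rfl
        · ring
        · rw [hσσ, bil_comm (z x) (σ x), hσz]; ring
        · rw [hσz, hzz]; ring
        · rw [hσw, h0]; ring
      | zero => rw [map_zero, LinearMap.zero_apply]
      | add y y' _ _ h h' => rw [map_add, LinearMap.add_apply, h, h', add_zero]
      | smul c y _ h => rw [map_smul, LinearMap.smul_apply, h, smul_zero]
    have h3 := Fintype.linearIndependent_iff.1 hli ![bil n (z x) u, -bil n (σ x) u, 0]
      (by
        rw [Fin.sum_univ_three]
        change bil n (z x) u • σ x + -bil n (σ x) u • z x + (0 : ℂ) • w x = 0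
        rw [← hzero]
        module) 1
    exact hσu (neg_eq_zero.1 h3)
  have hσp : bil n (σ x) p ≠ 0 := by
    intro h0
    -- The (1,0) derivative of (σ, w) = 0 reads (z, w) + (σ, p) = 0.
    have h1 := bil_part10_diff hU hσ.2.1 hws (fun y hy => hi01 y _ (hσ.2.2 y hy).2 _ (hwm y hy))
      hx (X x)
    rw [← hp, h0, add_zero] at h1
    exact hzw0 h1
  -- The basis p, σ, z, w of V has conjugates p', σ, w, z, all in V.
  have hspan := eq_span_of_orthogonal h4 (hV10 x hσ10) (hV10 x (hzm x hx)) (hV01 x (hwm x hx))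
    hpV hli hσσ hσz hσw hσp
  intro y hy
  rw [hspan] at hy
  induction hy using Submodule.span_induction with
  | mem y h =>
    rcases h with rfl | rfl | rfl | rfl
    · rw [hpp']; exact hp'V
    · rw [hσs x hx]; exact hV10 x hσ10
    · rw [hzw x hx]; exact hV01 x (hwm x hx)
    · rw [hwz x hx]; exact hV10 x (hzm x hx)
  | zero => rw [conjE_eq_zero.2 rfl]; exact (V x).zero_mem
  | add y y' _ _ h h' => rw [conjE_add]; exact (V x).add_mem h h'
  | smul c y _ h => rw [conjE_smul]; exact (V x).smul_mem _ h

/-- A smooth map with vanishing differential is locally constant. -/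
theorem isLocallyConstant_of_diff_eq_zero {F : Type*} [NormedAddCommGroup F] [NormedSpace ℝ F]
    {g : M → F} (hg : SmoothOn g Set.univ) (h : ∀ x v, diff g x v = 0) : IsLocallyConstant g := by
  have hM : IsManifold 𝓘(ℝ, ℂ) 1 M := IsManifold.of_le (n := ω) le_top
  rw [IsLocallyConstant.iff_eventually_eq]
  intro x
  set e := chartAt ℂ x with he
  have hex := mem_chart_source ℂ x
  have htarget : e x ∈ e.target := e.map_source hex
  obtain ⟨r, hr, hball⟩ := Metric.isOpen_iff.1 e.open_target _ htarget
  have hd : ∀ z ∈ Metric.ball (e x) r, HasFDerivAt (g ∘ e.symm) (0 : ℂ →L[ℝ] F) z := by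
    intro z hz
    have h1 : HasMFDerivAt 𝓘(ℝ, ℂ) 𝓘(ℝ, F) g (e.symm z) (diff g (e.symm z)) :=
      (hg.mdifferentiableAt isOpen_univ (Set.mem_univ _)).hasMFDerivAt
    have h2 := (mdifferentiableAt_atlas_symm (I := 𝓘(ℝ, ℂ)) (chart_mem_atlas ℂ x)
      (hball hz)).hasMFDerivAt
    have h3 := (h1.comp z h2).hasFDerivAt
    have h4 : diff g (e.symm z) = 0 := by ext1 v; exact h _ v
    rw [h4] at h3
    exact h3
  have hc : ∀ z ∈ Metric.ball (e x) r, (g ∘ e.symm) z = (g ∘ e.symm) (e x) := fun z hz =>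
    (convex_ball (e x) r).is_const_of_fderivWithin_eq_zero (𝕜 := ℝ)
      (fun z hz => (hd z hz).differentiableAt.differentiableWithinAt)
      (fun z hz => by rw [fderivWithin_of_isOpen Metric.isOpen_ball hz, (hd z hz).fderiv])
      hz (Metric.mem_ball_self hr)
  filter_upwards [e.open_source.mem_nhds hex,
    (e.continuousAt hex).preimage_mem_nhds (Metric.ball_mem_nhds _ hr)] with y hy hy2
  have := hc _ hy2
  rwa [Function.comp_apply, Function.comp_apply, e.left_inv hy, e.left_inv hex] at this

omit [ChartedSpace ℂ M] [IsManifold 𝓘(ℂ) ω M] in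
/-- A choice of one point in each connected component. -/
theorem exists_basePoint [LocallyConnectedSpace M] : ∃ c : M → M, IsLocallyConstant c ∧
    (∀ x, c x ∈ connectedComponent x) ∧ ∀ x, c (c x) = c x := by
  have hc : ∀ x : M, ((Quotient.out (ConnectedComponents.mk x) : M) : ConnectedComponents M)
      = ConnectedComponents.mk x := fun x => Quotient.out_eq _
  refine ⟨fun x => Quotient.out (ConnectedComponents.mk x), ?_, fun x => ?_, fun x => ?_⟩
  · rw [IsLocallyConstant.iff_eventually_eq]
    intro x
    -- Local connectedness makes components open, so the choice is locally constant.
    filter_upwards [isOpen_connectedComponent.mem_nhds (mem_connectedComponent (x := x))] with y hy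
    rw [ConnectedComponents.coe_eq_coe.2 (connectedComponent_eq hy)]
  · have := ConnectedComponents.coe_eq_coe.1 (hc x)
    rw [← this]
    exact mem_connectedComponent
  · dsimp only
    rw [hc]

/-- A parallel isometry for a real connection that is real at one point of each component is
real. -/
theorem IsParallelIsometry.isRealIso {a : Form M (EndE n)} (ha : IsRealForm a)
    {ψ : M → (E n ≃L[ℂ] E n)} (hψ : IsParallelIsometry a 0 ψ) {c : M → M}
    (hc : ∀ x, c x ∈ connectedComponent x) (h1 : ∀ x u, ψ (c x) u = u) : IsRealIso ψ := by
  intro x u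
  set w := ψ x u with hw
  -- The section ψ⁻¹ w is parallel for d + a, and so is its conjugate because a is real. Thus ψ conj
  -- ψ⁻¹ w is locally constant, with value ψ conj u at x and conj w at the base point.
  have hs : SmoothOn (fun y => (ψ y).symm w) Set.univ := hψ.1.symm.eval (SmoothOn.const w _)
  have hcs := hs.conjE
  have hpar : ∀ y v, cov a (fun y => (ψ y).symm w) y v = 0 := fun y v => by
    have h := hψ.2.2 Set.univ isOpen_univ _ hs y (Set.mem_univ y) v
    simp only [ContinuousLinearEquiv.apply_symm_apply] at h
    rw [cov_zero, diff_const] at h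
    exact (ψ y).map_eq_zero_iff.1 h.symm
  have hpar' : ∀ y v, diff (fun y => ψ y (conjE ((ψ y).symm w))) y v = 0 := fun y v => by
    have h := hψ.2.2 Set.univ isOpen_univ _ hcs y (Set.mem_univ y) v
    rw [cov_zero] at h
    rw [h, cov_apply, diff_conjE (hs.mdifferentiableAt isOpen_univ (Set.mem_univ y)), ha,
      ← conjE_add]
    refine (ψ y).map_eq_zero_iff.2 (conjE_eq_zero.2 ?_)
    exact hpar y v
  have hlc := isLocallyConstant_of_diff_eq_zero (hψ.1.eval hcs) hpar'
  have h2 := hlc.apply_eq_of_isPreconnected isPreconnected_connectedComponent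
    (mem_connectedComponent (x := x)) (hc x)
  have h3 : (ψ (c x)).symm w = w := by
    rw [ContinuousLinearEquiv.symm_apply_eq, h1]
  have h4 : (ψ x).symm w = u := (ψ x).symm_apply_apply u
  rw [h4, h3] at h2
  exact h2.trans (h1 x _)

/-- Parallel isometries for a real connection can be made real by locally constant isometries. -/
theorem IsParallelIsometry.exists_real {a : Form M (EndE n)} (ha : IsRealForm a)
    {φ : M → (E n ≃L[ℂ] E n)} (hφ : IsParallelIsometry a 0 φ) :
    ∃ ψ : M → (E n ≃L[ℂ] E n), IsParallelIsometry a 0 ψ ∧ IsRealIso ψ ∧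
      IsLocallyConstant (fun x => (φ x).symm.trans (ψ x)) := by
  have hM : LocallyConnectedSpace M := ChartedSpace.locallyConnectedSpace ℂ M
  obtain ⟨c, hlc, hmem, hcc⟩ := exists_basePoint (M := M)
  have hev : ∀ x, ∀ᶠ y in nhds x, c y = c x := (IsLocallyConstant.iff_eventually_eq c).1 hlc
  -- Dividing by the value at the base point makes ψ the identity there; near a given x the base
  -- point is fixed, so ψ differs from φ by a constant isometry.
  set ψ : M → (E n ≃L[ℂ] E n) := fun x => (φ x).trans (φ (c x)).symm with hψ
  have hloc : ∀ x, ∀ᶠ y in nhds x,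
      (ψ y : EndE n) = mulL n ((φ (c x)).symm : EndE n) (φ y : EndE n) := fun x => by
    filter_upwards [hev x] with y hy
    rw [← hy]
    rfl
  have hsm (x : M) : SmoothOn (fun y => mulL n ((φ (c x)).symm : EndE n) (φ y : EndE n))
      Set.univ := hφ.1.clm_comp (mulL n ((φ (c x)).symm : EndE n))
  have hpar : IsParallelIsometry a 0 ψ := by
    refine isParallelIsometry_of_diff (fun x hx => ?_) (fun x u w => ?_) (fun x v w => ?_)
    · exact ((hsm x).contMDiffAt (Filter.univ_mem)).congr_of_eventuallyEq (hloc x)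
        |>.contMDiffWithinAt
    · change bil n ((φ (c x)).symm (φ x u)) ((φ (c x)).symm (φ x w)) = _
      rw [← hφ.2.1 (c x), ContinuousLinearEquiv.apply_symm_apply,
        ContinuousLinearEquiv.apply_symm_apply, hφ.2.1 x]
    · have h1 : diff (fun y => (ψ y : EndE n)) x
          = diff (fun y => mulL n ((φ (c x)).symm : EndE n) (φ y : EndE n)) x :=
        Filter.EventuallyEq.mfderiv_eq (hloc x)
      rw [h1]
      have h2 := diff_clm_comp (hφ.1.mdifferentiableAt isOpen_univ (Set.mem_univ x))
        (mulL n ((φ (c x)).symm : EndE n)) v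
      rw [h2]
      change (φ (c x)).symm (diff (fun y => (φ y : EndE n)) x v w) = _
      rw [hφ.diff_apply]
      rfl
  refine ⟨ψ, hpar, hpar.isRealIso ha hmem fun x u => ?_, ?_⟩
  · change (φ (c (c x))).symm (φ (c x) u) = u
    rw [hcc, ContinuousLinearEquiv.symm_apply_apply]
  · have e : (fun x => (φ x).symm.trans (ψ x)) = (fun y => (φ y).symm) ∘ c := by
      funext x
      ext1
      funext w
      change (φ (c x)).symm (φ x ((φ x).symm w)) = (φ (c x)).symm w
      rw [ContinuousLinearEquiv.apply_symm_apply]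
    rw [e]
    exact hlc.comp _

/-- On Λ the connection d^{λ,q}_V is d, so φ maps the span of a section and its derivatives
isomorphically onto that of the image section. -/
theorem IsRealSurface.mapBundle {V L10 L01 : M → Submodule ℂ (E n)} {q : Form M (EndE n)} {t : ℂ}
    (hL : IsRealSurface L10 L01) (h : IsConstrainedWillmoreVia 0 q V L10 L01)
    {φ : M → (E n ≃L[ℂ] E n)} (hφ : IsParallelIsometry (loopConn 0 V q t) 0 φ)
    (hφr : IsRealIso φ) (hS : IsSurface 0 (mapBundle φ L10) (mapBundle φ L01)) :
    IsRealSurface (Willmore.mapBundle φ L10) (Willmore.mapBundle φ L01) := by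
  obtain ⟨⟨hb10, hb01, hi10, hi01, hb, hsec⟩, ⟨hV4, hnd, hle, hN10, hN01⟩, -, hq10, hq01⟩ := h
  refine ⟨hS, ?_, ?_⟩
  · rw [mapBundle_inf]
    rintro x _ ⟨w, hw, rfl⟩
    exact ⟨conjE w, hL.2.1 x w hw, hφr x w⟩
  · rw [mapBundle_inf]
    intro U r hr hr0 x hx
    have hs := hr.symm hφ.1
    have hs0 : ∀ y ∈ U, (φ y).symm (r y) ≠ 0 := fun y hy h0 =>
      hr0 y hy ((φ y).symm.map_eq_zero_iff.1 h0)
    rw [← hL.2.2 U _ hs hs0 x hx]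
    obtain ⟨m1, m2⟩ := hs.2.2 x hx
    have hcov : ∀ v : T x, cov 0 r x v = φ x (cov 0 (fun y => (φ y).symm (r y)) x v) := fun v => by
      rw [hr.cov_eq hφ hx, cov_zero, cov_apply, ← part10_add_part01_apply,
        part10_loopConn_eq_zero hN10 hi01 hq10 m2, part01_loopConn_eq_zero hN01 hi10 hq01 m1,
        add_zero, add_zero]
    rw [← LinearEquiv.finrank_map_eq (φ x).toLinearEquiv
      (Submodule.span ℂ (insert ((φ x).symm (r x)) _))]
    have e : Submodule.span ℂ (insert (r x) (Set.range fun v => cov 0 r x v))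
        = (Submodule.span ℂ (insert ((φ x).symm (r x)) (Set.range fun v =>
          cov 0 (fun y => (φ y).symm (r y)) x v))).map (φ x).toLinearEquiv.toLinearMap := by
      rw [Submodule.map_span, Set.image_insert_eq, ← Set.range_comp]
      congr 2
      · exact ((φ x).apply_symm_apply _).symm
      · exact congrArg Set.range (funext hcov)
    rw [e]

end RealSurfaces

end Willmore

open Willmore
theorem mainTheorem1 {M : Type*} [TopologicalSpace M] [ChartedSpace ℂ M] [IsManifold 𝓘(ℂ) ω M]
    {n : ℕ} (q : Form M (EndE n)) (V L10 L01 : M → Submodule ℂ (E n))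
    (h : IsConstrainedWillmoreVia 0 q V L10 L01) :
    (∀ t : ℂ, t ≠ 0 → ∀ φ : M → (E n ≃L[ℂ] E n), IsParallelIsometry (loopConn 0 V q t) 0 φ →
      IsConstrainedHarmonic 0 (adForm φ (qLam q t)) (mapBundle φ V) ∧
      IsCentralSphereCongruence 0 (mapBundle φ V) (mapBundle φ L10) (mapBundle φ L01) ∧
      IsConstrainedWillmoreVia 0 (adForm φ (qLam q t)) (mapBundle φ V)
        (mapBundle φ L10) (mapBundle φ L01) ∧
      IsConstrainedWillmore 0 (adForm φ (qLam q t)) (mapBundle φ L10) (mapBundle φ L01)) ∧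
    (IsRealSurface L10 L01 → IsRealForm q → ∀ t : ℂ, ‖t‖ = 1 →
      (∀ φ : M → (E n ≃L[ℂ] E n), IsParallelIsometry (loopConn 0 V q t) 0 φ →
        ∃ ψ : M → (E n ≃L[ℂ] E n), IsParallelIsometry (loopConn 0 V q t) 0 ψ ∧ IsRealIso ψ ∧
          IsLocallyConstant (fun x => (φ x).symm.trans (ψ x))) ∧
      (∀ φ : M → (E n ≃L[ℂ] E n), IsParallelIsometry (loopConn 0 V q t) 0 φ → IsRealIso φ →
        IsRealConstrainedWillmore (adForm φ (qLam q t)) (mapBundle φ L10) (mapBundle φ L01))) := by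
  refine ⟨fun t ht φ hφ => ?_, fun hL hq t ht => ?_⟩
  · have h' := h.mapBundle ht hφ
    exact ⟨h'.2.2.1, h'.2.1, h', _, h'⟩
  · have ht0 : t ≠ 0 := by
      rintro rfl
      simp at ht
    have htc : (starRingEnd ℂ) t = t⁻¹ := (Complex.inv_eq_conj ht).symm
    -- Reality of V is a consequence of the reality of Λ and the immersion condition; it is what
    -- makes N real.
    have hV := h.2.1.isRealBundle hL
    have hN := isRealForm_formN (smoothOn_projV h.2.1.1 h.2.1.2.1) h.2.1.2.1 hV
    refine ⟨fun φ hφ => hφ.exists_real (isRealForm_loopConn hN hq htc), fun φ hφ hφr => ?_⟩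
    have h' := h.mapBundle ht0 hφ
    exact ⟨⟨_, h'⟩, hL.mapBundle h hφ hφr h'.1, isRealForm_adForm (isRealForm_qLam hq htc) hφr⟩
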